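/- Let $G$ be a finite simple graph on $n\ge 4$ vertices that contains no cycle $C_4$ of length 4 as a subgraph, and let $G$ be embedded in the plane (vertices are distinct points; each edge is a simple arc joining its two ends and passing through no other vertex; two different edges meet at most in common ends). Let $\varepsilon(G)$ be the number of edges of $G$. The faces are the connected components of the complement of the drawing, the length of a face is the number of edges on its boundary, bridges being counted twice, $f_k$ is the number of faces of length $k$, and $r$ is the maximum length of a face. Let $\tau(G)$ be the number of edges that do not lie on the boundary of any triangular face (face of length 3). Then $$\varepsilon(G)\le \frac{15}{7}(n-2),$$ and if $G$ is connected, then there are finitely many faces and $$\varepsilon(G)=\frac{15}{7}(n-2)-\frac{2}{7}\tau(G)-\sum_{k=6}^{r}\frac{3(k-5)}{7}f_k .$$ Moreover, if $G$ is connected and every triangle (cycle of length 3) of $G$ is the boundary of a face, then $\tau(G)$ equals the number of edges of $G$ that are contained in no triangle of $G$. -/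

import Mathlib

/-- `A` is a simple arc in the plane with end points `p` and `q`: the image of a continuous
injective map of the unit interval that starts at `p` and stops at `q`. -/
def IsPlaneArc (p q : ℂ) (A : Set ℂ) : Prop :=
  ∃ γ : unitInterval → ℂ,
    Continuous γ ∧ Function.Injective γ ∧ γ 0 = p ∧ γ 1 = q ∧ Set.range γ = A

/-- An embedding of the graph `G` in the plane (the complex plane): distinct vertices are
distinct points, every edge is a simple arc that joins its two end vertices and contains no other
vertex, and two different edges meet at most in common end vertices.
The value of `arc` at unordered pairs that are not edges of `G` plays no role. -/
structure PlaneEmbedding {V : Type*} (G : SimpleGraph V) where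
  /-- the point that represents a vertex -/
  point : V → ℂ
  /-- the arc that represents an edge -/
  arc : Sym2 V → Set ℂ
  point_injective : Function.Injective point
  isPlaneArc : ∀ u v : V, G.Adj u v → IsPlaneArc (point u) (point v) (arc s(u, v))
  mem_of_point_mem_arc : ∀ e ∈ G.edgeSet, ∀ w : V, point w ∈ arc e → w ∈ e
  arc_inter_arc : ∀ e ∈ G.edgeSet, ∀ e' ∈ G.edgeSet, e ≠ e' →
    arc e ∩ arc e' ⊆ point '' {w | w ∈ e ∧ w ∈ e'}

namespace PlaneEmbedding

/-- The set of points of the plane that are covered by the drawing of `G`. -/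
def support {V : Type*} {G : SimpleGraph V} (D : PlaneEmbedding G) : Set ℂ :=
  Set.range D.point ∪ ⋃ e ∈ G.edgeSet, D.arc e

/-- The faces: the connected components of the complement of the drawing. -/
def faces {V : Type*} {G : SimpleGraph V} (D : PlaneEmbedding G) : Set (Set ℂ) :=
  {F | ∃ x ∈ D.supportᶜ, F = connectedComponentIn D.supportᶜ x}

/-- The edges of `G` that lie on the boundary of `F`. -/
def boundaryEdges {V : Type*} {G : SimpleGraph V} (D : PlaneEmbedding G) (F : Set ℂ) :
    Set (Sym2 V) :=
  {e | e ∈ G.edgeSet ∧ D.arc e ⊆ frontier F}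

/-- The length of a face: the number of edges on its boundary, bridges being counted twice. -/
noncomputable def faceLength {V : Type*} {G : SimpleGraph V} (D : PlaneEmbedding G)
    (F : Set ℂ) : ℕ :=
  (D.boundaryEdges F).ncard + {e | e ∈ D.boundaryEdges F ∧ G.IsBridge e}.ncard

/-- `f_k`: the number of faces of length `k`. -/
noncomputable def numFaces {V : Type*} {G : SimpleGraph V} (D : PlaneEmbedding G) (k : ℕ) : ℕ :=
  {F | F ∈ D.faces ∧ D.faceLength F = k}.ncard

/-- `r`: the maximum length of a face. -/
noncomputable def maxFaceLength {V : Type*} {G : SimpleGraph V} (D : PlaneEmbedding G) : ℕ :=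
  sSup (D.faceLength '' D.faces)

/-- `Γ`: the edges that do not lie on the boundary of any triangular face (face of length 3). -/
def uncoveredEdges {V : Type*} {G : SimpleGraph V} (D : PlaneEmbedding G) : Set (Sym2 V) :=
  {e | e ∈ G.edgeSet ∧ ¬ ∃ F ∈ D.faces, D.faceLength F = 3 ∧ e ∈ D.boundaryEdges F}

/-- `τ`: the number of edges that do not lie on the boundary of any triangular face. -/
noncomputable def tau {V : Type*} {G : SimpleGraph V} (D : PlaneEmbedding G) : ℕ :=
  D.uncoveredEdges.ncard

/-- Every triangle (cycle of length 3) of `G` is the boundary of some face. -/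
def TrianglesBoundFaces {V : Type*} {G : SimpleGraph V} (D : PlaneEmbedding G) : Prop :=
  ∀ u v w : V, G.Adj u v → G.Adj v w → G.Adj w u →
    ∃ F ∈ D.faces, D.boundaryEdges F = {s(u, v), s(v, w), s(w, u)}

end PlaneEmbedding

/-- The edges of `G` that are contained in no triangle (cycle of length 3) of `G`. -/
def edgesInNoTriangle {V : Type*} (G : SimpleGraph V) : Set (Sym2 V) :=
  {e | e ∈ G.edgeSet ∧ ¬ ∃ u v w : V, G.Adj u v ∧ G.Adj v w ∧ G.Adj w u ∧ e = s(u, v)}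

/-! Write ε, f, n for the numbers of edges, faces and vertices. Suppose first that the graph is
connected. Every non-bridge edge of a face boundary lies on a cycle inside that boundary. Without
four-cycles and with n ≥ 4, this leaves only triangular faces and faces of length at least 5
(`isTriangleEdges_or_five_le`). Two triangles with a common edge coincide, since otherwise they
would form a four-cycle, and two faces bounded by one triangle would exhaust the plane and force n =
3. Hence the triangular faces are edge-disjoint and 3 f₃ + τ = ε. The face lengths sum to 2ε, and
Euler's formula gives f = ε + 2 - n. Summing length - 5 over all faces yields ∑_{k≥6} (k - 5) f_k -
2 f₃ = 5(n - 2) - 3ε. Substituting f₃ = (ε - τ)/3 and multiplying by 3/7 gives the formula.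

If the graph is disconnected, the weaker bound 7ε + 15 ≤ 15n holds for every nonempty vertex set.
Adding it over two parts with no edges between them gives 7ε + 30 ≤ 15n.

The topological input is the effect of adding one arc, with only its ends on a compact set K, to K.
Only the component containing the open arc changes. A bridge turns it into one component
(`faces_of_isBridge`). Any other edge turns it into exactly two, each with the whole arc in its
closure (`faces_of_not_isBridge`). Finiteness, Euler's formula and the incidence of edges and faces
follow by deleting edges.

These facts are proved with continuous logarithms, after Eilenberg. An integer function c that is
locally constant off X ∪ Y yields a nonvanishing function off X ∩ Y, its coboundary. If that
function has a logarithm, c is a difference of locally constant functions off X and off Y. A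
logarithm always exists when X ∩ Y is a point. When it is a pair, the only obstruction is one
winding number, so X ∪ Y cannot separate three points that neither X nor Y separates. Conversely, an
arc whose ends are joined in K does separate, since otherwise (z - a)/(z - b) would have a logarithm
off {a, b}. -/

open Set Filter Topology

/-! ### Connected subsets of planar sets -/

/-- `x` and `y` lie in a common connected subset of `U`. -/
def Linked (U : Set ℂ) (x y : ℂ) : Prop :=
  ∃ C ⊆ U, IsPreconnected C ∧ x ∈ C ∧ y ∈ C

namespace Linked

variable {U W : Set ℂ} {x y z : ℂ}

theorem left_mem (h : Linked U x y) : x ∈ U := by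
  obtain ⟨C, hC, -, hx, -⟩ := h
  exact hC hx

theorem symm (h : Linked U x y) : Linked U y x := by
  obtain ⟨C, hC, hp, hx, hy⟩ := h
  exact ⟨C, hC, hp, hy, hx⟩

theorem right_mem (h : Linked U x y) : y ∈ U := h.symm.left_mem

theorem mono (h : Linked U x y) (hUW : U ⊆ W) : Linked W x y := by
  obtain ⟨C, hC, hp, hx, hy⟩ := h
  exact ⟨C, hC.trans hUW, hp, hx, hy⟩

theorem refl (h : x ∈ U) : Linked U x x :=
  ⟨{x}, by simpa using h, isPreconnected_singleton, rfl, rfl⟩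

theorem trans (h : Linked U x y) (h' : Linked U y z) : Linked U x z := by
  obtain ⟨C, hC, hp, hx, hy⟩ := h
  obtain ⟨C', hC', hp', hy', hz⟩ := h'
  exact ⟨C ∪ C', union_subset hC hC', hp.union y hy hy' hp', Or.inl hx, Or.inr hz⟩

theorem iff_mem_component : Linked U x y ↔ x ∈ U ∧ y ∈ connectedComponentIn U x := by
  constructor
  · rintro ⟨C, hC, hp, hx, hy⟩
    exact ⟨hC hx, hp.subset_connectedComponentIn hx hC hy⟩
  · rintro ⟨hx, hy⟩
    exact ⟨_, connectedComponentIn_subset U x, isPreconnected_connectedComponentIn,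
      mem_connectedComponentIn hx, hy⟩

theorem mem_component (h : Linked U x y) : y ∈ connectedComponentIn U x :=
  (iff_mem_component.1 h).2

end Linked

theorem IsPreconnected.linked {C U : Set ℂ} (hC : IsPreconnected C) (hU : C ⊆ U) {x y : ℂ}
    (hx : x ∈ C) (hy : y ∈ C) : Linked U x y := ⟨C, hU, hC, hx, hy⟩

/-- The set of complex numbers of large norm is connected. -/
theorem isPreconnected_norm_gt (R : ℝ) (hR : 0 < R) : IsPreconnected {z : ℂ | R < ‖z‖} := by
  have h : {z : ℂ | R < ‖z‖} = Complex.exp '' {z : ℂ | Real.log R < z.re} := by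
    ext z
    simp only [mem_ofPred_eq, mem_image]
    constructor
    · intro hz
      have hz0 : z ≠ 0 := by
        rintro rfl
        simp at hz
        linarith
      exact ⟨Complex.log z, by rw [Complex.log_re]; exact Real.log_lt_log hR hz,
        Complex.exp_log hz0⟩
    · rintro ⟨w, hw, rfl⟩
      rw [Complex.norm_exp]
      exact (Real.log_lt_iff_lt_exp hR).1 hw
  rw [h]
  exact ((convex_halfSpace_re_gt _).isPreconnected).image _ Complex.continuous_exp.continuousOn

/-! ### Continuous logarithms and the Mayer-Vietoris coboundary -/

/-- A continuous function with values in `2πiℤ` is constant on connected sets. -/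
theorem eq_of_exp_eq_one {C : Set ℂ} (hC : IsPreconnected C) {f : ℂ → ℂ}
    (hf : ContinuousOn f C) (h : ∀ z ∈ C, Complex.exp (f z) = 1) {x y : ℂ}
    (hx : x ∈ C) (hy : y ∈ C) : f x = f y := by
  have key : ∀ z ∈ C, ∃ n : ℤ, f z = n * (2 * Real.pi * Complex.I) := fun z hz =>
    Complex.exp_eq_one_iff.1 (h z hz)
  have h2 : (2 * Real.pi * Complex.I : ℂ) ≠ 0 := Complex.two_pi_I_ne_zero
  let F : ℂ → ℝ := fun z => (f z / (2 * Real.pi * Complex.I)).re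
  have hF : ContinuousOn F C := Complex.continuous_re.comp_continuousOn (hf.div_const _)
  have hn : ∀ z ∈ C, ∃ n : ℤ, f z = n * (2 * Real.pi * Complex.I) ∧ F z = n := by
    intro z hz
    obtain ⟨n, hn⟩ := key z hz
    refine ⟨n, hn, ?_⟩
    simp only [F, hn, mul_div_cancel_right₀ _ h2]
    simp
  have hd : IsDiscrete (Set.range ((↑) : ℤ → ℝ)) :=
    Int.isClosedEmbedding_coe_real.isEmbedding.isDiscrete_range
  have hF' : F x = F y := hC.constant_of_mapsTo (T := Set.range ((↑) : ℤ → ℝ)) hd hF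
    (fun z hz => by
      obtain ⟨n, -, hn⟩ := hn z hz
      exact ⟨n, hn.symm⟩) hx hy
  obtain ⟨n, h1, h1'⟩ := hn x hx
  obtain ⟨m, h3, h3'⟩ := hn y hy
  rw [h1', h3'] at hF'
  have : n = m := by exact_mod_cast hF'
  rw [h1, h3, this]

/-- Continuous nonvanishing functions on the plane have continuous logarithms. -/
theorem exists_continuous_log {h : ℂ → ℂ} (hc : Continuous h) (h0 : ∀ z, h z ≠ 0) :
    ∃ L : ℂ → ℂ, Continuous L ∧ ∀ z, Complex.exp (L z) = h z := by
  obtain ⟨F, ⟨-, hF⟩, -⟩ := Complex.isCoveringMap_exp.existsUnique_continuousMap_lifts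
    (A := ℂ) ⟨fun z => (⟨h z, h0 z⟩ : {z : ℂ // z ≠ 0}), by fun_prop⟩ (a₀ := 0)
    (e₀ := Complex.log (h 0)) (Subtype.ext (Complex.exp_log (h0 0)))
  refine ⟨F, F.continuous, fun z => ?_⟩
  have := congrArg Subtype.val (congrFun hF z)
  simpa using this

/-- A separating function for two closed sets, locally constant near each of them away from
the intersection. -/
theorem exists_bump {X Y : Set ℂ} (hX : IsClosed X) (hY : IsClosed Y) (hX0 : X.Nonempty)
    (hY0 : Y.Nonempty) : ∃ ρ : ℂ → ℝ, ContinuousOn ρ (X ∩ Y)ᶜ ∧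
      (∀ z ∈ X, z ∉ Y → ∀ᶠ w in 𝓝 z, ρ w = 1) ∧ (∀ z ∈ Y, z ∉ X → ∀ᶠ w in 𝓝 z, ρ w = 0) := by
  let r : ℂ → ℝ := fun z => Metric.infDist z Y / (Metric.infDist z X + Metric.infDist z Y)
  have hr : ContinuousOn r (X ∩ Y)ᶜ := by
    refine ContinuousOn.div (Metric.continuous_infDist_pt Y).continuousOn
      ((Metric.continuous_infDist_pt X).add (Metric.continuous_infDist_pt Y)).continuousOn ?_
    intro z hz h
    have h1 := Metric.infDist_nonneg (x := z) (s := X)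
    have h2 := Metric.infDist_nonneg (x := z) (s := Y)
    apply hz
    exact ⟨(hX.mem_iff_infDist_zero hX0).2 (by linarith),
      (hY.mem_iff_infDist_zero hY0).2 (by linarith)⟩
  have hO : IsOpen (X ∩ Y)ᶜ := (hX.inter hY).isOpen_compl
  -- The ratio `r` is 1 on X off Y and 0 on Y off X. Stretching and clamping makes the result
  -- constant wherever `r` exceeds 2/3 or is below 1/3, hence on neighbourhoods.
  refine ⟨fun z => max 0 (min 1 (3 * r z - 1)), by fun_prop, ?_, ?_⟩
  · intro z hz hz'
    have h1 : r z = 1 := by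
      have : Metric.infDist z X = 0 := (hX.mem_iff_infDist_zero hX0).1 hz
      have h2 : Metric.infDist z Y ≠ 0 := fun h => hz' ((hY.mem_iff_infDist_zero hY0).2 h)
      simp [r, this, h2]
    have hcz : ContinuousAt r z := hr.continuousAt (hO.mem_nhds (fun h => hz' h.2))
    have := hcz.eventually (lt_mem_nhds (show (2 / 3 : ℝ) < r z by rw [h1]; norm_num))
    filter_upwards [this] with w hw
    rw [min_eq_left (by linarith)]
    simp
  · intro z hz hz'
    have h1 : r z = 0 := by
      have : Metric.infDist z Y = 0 := (hY.mem_iff_infDist_zero hY0).1 hz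
      simp [r, this]
    have hcz : ContinuousAt r z := hr.continuousAt (hO.mem_nhds (fun h => hz' h.1))
    have := hcz.eventually (gt_mem_nhds (show r z < (1 / 3 : ℝ) by rw [h1]; norm_num))
    filter_upwards [this] with w hw
    rw [max_eq_left]
    exact (min_le_right _ _).trans (by linarith)

/-- The Mayer-Vietoris coboundary of an integer valued function. -/
noncomputable def coboundary (c : ℂ → ℤ) (ρ : ℂ → ℝ) (z : ℂ) : ℂ :=
  Complex.exp (2 * Real.pi * Complex.I * (c z * ρ z))

theorem coboundary_ne_zero (c : ℂ → ℤ) (ρ : ℂ → ℝ) (z : ℂ) : coboundary c ρ z ≠ 0 :=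
  Complex.exp_ne_zero _

theorem exp_two_pi_I_mul_int (n : ℤ) : Complex.exp (2 * Real.pi * Complex.I * n) = 1 := by
  rw [mul_comm]
  exact Complex.exp_int_mul_two_pi_mul_I n

theorem coboundary_continuousOn {X Y : Set ℂ} (hX : IsClosed X) (hY : IsClosed Y) {c : ℂ → ℤ}
    (hc : ∀ z ∉ X ∪ Y, ∀ᶠ w in 𝓝 z, c w = c z) {ρ : ℂ → ℝ} (hρ : ContinuousOn ρ (X ∩ Y)ᶜ)
    (h1 : ∀ z ∈ X, z ∉ Y → ∀ᶠ w in 𝓝 z, ρ w = 1)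
    (h0 : ∀ z ∈ Y, z ∉ X → ∀ᶠ w in 𝓝 z, ρ w = 0) :
    ContinuousOn (coboundary c ρ) (X ∩ Y)ᶜ := by
  intro z hz
  apply ContinuousAt.continuousWithinAt
  by_cases hzX : z ∈ X
  · have hzY : z ∉ Y := fun h => hz ⟨hzX, h⟩
    refine (continuousAt_const (y := (1 : ℂ))).congr ?_
    filter_upwards [h1 z hzX hzY] with w hw
    simp [coboundary, hw, exp_two_pi_I_mul_int]
  by_cases hzY : z ∈ Y
  · refine (continuousAt_const (y := (1 : ℂ))).congr ?_
    filter_upwards [h0 z hzY hzX] with w hw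
    simp [coboundary, hw]
  · have hcz := hc z (by simp [hzX, hzY])
    have hρz : ContinuousAt ρ z := hρ.continuousAt ((hX.inter hY).isOpen_compl.mem_nhds hz)
    have : ContinuousAt (fun w => Complex.exp (2 * Real.pi * Complex.I * (c z * ρ w))) z := by
      fun_prop
    refine this.congr ?_
    filter_upwards [hcz] with w hw
    simp [coboundary, hw]

/-- If the coboundary has a logarithm then the function is a difference of locally constant
functions on the two open sets. -/
theorem eq_of_coboundary_eq_exp {X Y : Set ℂ} (hX : IsClosed X) (hY : IsClosed Y) {c : ℂ → ℤ}
    (hc : ∀ z ∉ X ∪ Y, ∀ᶠ w in 𝓝 z, c w = c z) {ρ : ℂ → ℝ} (hρ : ContinuousOn ρ (X ∩ Y)ᶜ)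
    (h1 : ∀ z ∈ X, z ∉ Y → ∀ᶠ w in 𝓝 z, ρ w = 1)
    (h0 : ∀ z ∈ Y, z ∉ X → ∀ᶠ w in 𝓝 z, ρ w = 0) {t : ℂ → ℂ} (ht : ContinuousOn t (X ∩ Y)ᶜ)
    (htc : ∀ z ∉ X ∩ Y, Complex.exp (t z) = coboundary c ρ z) {x y : ℂ}
    (hxy : Linked Xᶜ x y) (hxy' : Linked Yᶜ x y) : c x = c y := by
  have hO : IsOpen (X ∩ Y)ᶜ := (hX.inter hY).isOpen_compl
  -- Both functions take values in 2πiℤ on their domains, and their difference is 2πi c. The bump is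
  -- 0 near Y off X, so `u` is continuous across Y; it is 1 near X off Y, so `v` is continuous
  -- across X.
  let u : ℂ → ℂ := fun z => 2 * Real.pi * Complex.I * (c z * ρ z) - t z
  let v : ℂ → ℂ := fun z => 2 * Real.pi * Complex.I * (c z * (ρ z - 1)) - t z
  have hcont : ∀ (κ : ℝ) (z : ℂ), z ∉ X → z ∉ Y →
      ContinuousAt (fun w => 2 * Real.pi * Complex.I * (c w * (ρ w - κ)) - t w) z := by
    intro κ z hzX hzY
    have hz : z ∈ (X ∩ Y)ᶜ := fun h => hzX h.1
    have hcz := hc z (by simp [hzX, hzY])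
    have hρz : ContinuousAt ρ z := hρ.continuousAt (hO.mem_nhds hz)
    have htz : ContinuousAt t z := ht.continuousAt (hO.mem_nhds hz)
    have : ContinuousAt (fun w => 2 * Real.pi * Complex.I * (c z * (ρ w - κ)) - t w) z := by
      fun_prop
    refine this.congr ?_
    filter_upwards [hcz] with w hw
    simp [hw]
  have hu : ContinuousOn u Xᶜ := by
    intro z hzX
    apply ContinuousAt.continuousWithinAt
    by_cases hzY : z ∈ Y
    · have htz : ContinuousAt t z := ht.continuousAt (hO.mem_nhds (fun h => hzX h.1))
      refine htz.neg.congr ?_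
      filter_upwards [h0 z hzY hzX] with w hw
      simp [u, hw]
    · simpa [u] using hcont 0 z hzX hzY
  have hv : ContinuousOn v Yᶜ := by
    intro z hzY
    apply ContinuousAt.continuousWithinAt
    by_cases hzX : z ∈ X
    · have htz : ContinuousAt t z := ht.continuousAt (hO.mem_nhds (fun h => hzY h.2))
      refine htz.neg.congr ?_
      filter_upwards [h1 z hzX hzY] with w hw
      simp [v, hw]
    · simpa [v] using hcont 1 z hzX hzY
  have hu1 : ∀ z ∈ Xᶜ, Complex.exp (u z) = 1 := by
    intro z hz
    rw [Complex.exp_sub, htc z (fun h => hz h.1)]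
    exact div_self (coboundary_ne_zero _ _ _)
  have hv1 : ∀ z ∈ Yᶜ, Complex.exp (v z) = 1 := by
    intro z hz
    have : v z = 2 * Real.pi * Complex.I * (c z * ρ z) - t z - 2 * Real.pi * Complex.I * c z := by
      simp only [v]
      ring
    rw [this, Complex.exp_sub, Complex.exp_sub, htc z (fun h => hz h.2), exp_two_pi_I_mul_int,
      div_one]
    exact div_self (coboundary_ne_zero _ _ _)
  obtain ⟨C, hC, hCp, hCx, hCy⟩ := hxy
  obtain ⟨C', hC', hCp', hCx', hCy'⟩ := hxy'
  have e1 : u x = u y := eq_of_exp_eq_one hCp (hu.mono hC) (fun z hz => hu1 z (hC hz)) hCx hCy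
  have e2 : v x = v y := eq_of_exp_eq_one hCp' (hv.mono hC') (fun z hz => hv1 z (hC' hz)) hCx' hCy'
  have e3 : (2 * Real.pi * Complex.I : ℂ) * c x = 2 * Real.pi * Complex.I * c y := by
    have hx : (2 * Real.pi * Complex.I : ℂ) * c x = u x - v x := by
      simp only [u, v]
      ring
    have hy : (2 * Real.pi * Complex.I : ℂ) * c y = u y - v y := by
      simp only [u, v]
      ring
    rw [hx, hy, e1, e2]
  have := mul_left_cancel₀ Complex.two_pi_I_ne_zero e3
  exact_mod_cast this

/-! ### Logarithms off one point and off two points -/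

/-- A nonvanishing continuous function on the complement of a point that equals one near infinity
has a continuous logarithm. -/
theorem exists_log_compl_singleton {g : ℂ → ℂ} {p : ℂ} (hg : ContinuousOn g {p}ᶜ)
    (h0 : ∀ z, g z ≠ 0) {R : ℝ} (hR : ∀ z : ℂ, R < ‖z‖ → g z = 1) :
    ∃ t : ℂ → ℂ, ContinuousOn t {p}ᶜ ∧ ∀ z ≠ p, Complex.exp (t z) = g z := by
  classical
  -- Inversion at p moves infinity to 0, where the value 1 fills the gap continuously; the result is
  -- defined on the whole plane.
  let h : ℂ → ℂ := fun w => if w = 0 then 1 else g (p + w⁻¹)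
  have hh : Continuous h := by
    rw [continuous_iff_continuousAt]
    intro w
    by_cases hw : w = 0
    · subst hw
      refine (continuousAt_const (y := (1 : ℂ))).congr ?_
      have hlim : Tendsto (fun w : ℂ => ‖p + w⁻¹‖) (𝓝[≠] 0) atTop := by
        have h1 : Tendsto (fun w : ℂ => ‖w⁻¹‖) (𝓝[≠] 0) atTop :=
          tendsto_norm_cobounded_atTop.comp tendsto_inv₀_nhdsNE_zero
        have h2 : Tendsto (fun w : ℂ => ‖w⁻¹‖ - ‖p‖) (𝓝[≠] 0) atTop :=
          tendsto_atTop_add_const_right _ _ h1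
        refine tendsto_atTop_mono (fun w => ?_) h2
        have := norm_sub_le (p + w⁻¹) p
        simp only [add_sub_cancel_left] at this
        linarith
      have := hlim.eventually_gt_atTop R
      rw [eventually_nhdsWithin_iff] at this
      filter_upwards [this] with w hw
      by_cases hw0 : w = 0
      · simp [h, hw0]
      · simp only [h, hw0, if_false]
        exact (hR _ (hw hw0)).symm
    · have hgc : ContinuousAt g (p + w⁻¹) :=
        hg.continuousAt (isOpen_compl_singleton.mem_nhds (by simpa using hw))
      have : ContinuousAt (fun w => g (p + w⁻¹)) w :=
        ContinuousAt.comp (f := fun w : ℂ => p + w⁻¹) hgc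
          (continuousAt_const.add (continuousAt_inv₀ hw))
      refine this.congr ?_
      filter_upwards [isOpen_compl_singleton.mem_nhds hw] with v hv
      simp only [mem_compl_iff, mem_singleton_iff] at hv
      simp [h, hv]
  have hh0 : ∀ w, h w ≠ 0 := by
    intro w
    by_cases hw : w = 0
    · simp [h, hw]
    · simpa [h, hw] using h0 _
  obtain ⟨L, hL, hLe⟩ := exists_continuous_log hh hh0
  refine ⟨fun z => L (z - p)⁻¹, ?_, ?_⟩
  · refine hL.comp_continuousOn ?_
    refine ContinuousOn.inv₀ (by fun_prop) ?_
    intro z hz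
    exact sub_ne_zero.2 hz
  · intro z hz
    have : (z - p)⁻¹ ≠ 0 := inv_ne_zero (sub_ne_zero.2 hz)
    rw [hLe]
    simp [h, sub_ne_zero.2 hz]

/-- A continuous `2πi`-periodic function descends through the complex exponential. -/
theorem continuousOn_comp_log {M : ℂ → ℂ} (hM : Continuous M)
    (hp : Function.Periodic M (2 * Real.pi * Complex.I)) :
    ContinuousOn (fun w => M (Complex.log w)) {0}ᶜ := by
  intro w₀ hw₀
  have hw₀ : w₀ ≠ 0 := hw₀
  apply ContinuousAt.continuousWithinAt
  -- This branch of the logarithm is continuous at w₀ even on the cut of the principal one, from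
  -- which it differs by a multiple of the period.
  have h1 : ContinuousAt (fun w => M (Complex.log (w / w₀) + Complex.log w₀)) w₀ := by
    refine hM.continuousAt.comp (ContinuousAt.add ?_ continuousAt_const)
    exact (continuousAt_id.div_const _).clog (by simp [hw₀])
  refine h1.congr ?_
  filter_upwards [isOpen_compl_singleton.mem_nhds hw₀] with w hw
  have hw : w ≠ 0 := hw
  have : Complex.exp (Complex.log (w / w₀) + Complex.log w₀) = Complex.exp (Complex.log w) := by
    rw [Complex.exp_add, Complex.exp_log hw₀, Complex.exp_log hw, Complex.exp_log (by positivity)]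
    field_simp
  obtain ⟨n, hn⟩ := Complex.exp_eq_exp_iff_exists_int.1 this
  rw [hn]
  exact hp.int_mul n _

/-- The degree of a nonvanishing function on the complement of two points. -/
theorem exists_log_lift_compl_pair {g : ℂ → ℂ} {a b : ℂ} (hab : a ≠ b)
    (hg : ContinuousOn g {a, b}ᶜ) (h0 : ∀ z, g z ≠ 0) {R : ℝ}
    (hR : ∀ z : ℂ, R < ‖z‖ → g z = 1) :
    ∃ (L : ℂ → ℂ) (m : ℤ), Continuous L ∧
      (∀ ζ, L (ζ + 2 * Real.pi * Complex.I) = L ζ + m * (2 * Real.pi * Complex.I)) ∧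
      ∀ ζ z, z ≠ a → z ≠ b → Complex.exp ζ = (z - a) / (z - b) → Complex.exp (L ζ) = g z := by
  classical
  -- Inverse of z ↦ (z - a)/(z - b): it sends 0 to a, infinity to b and 1 to infinity. Thus `h`
  -- lives on the plane without 0 and pulls back to the whole plane along the exponential.
  let T : ℂ → ℂ := fun w => (a - b * w) / (1 - w)
  let h : ℂ → ℂ := fun w => if w = 1 then 1 else g (T w)
  have hT : ∀ w, w ≠ 0 → w ≠ 1 → T w ∈ ({a, b} : Set ℂ)ᶜ := by
    intro w hw0 hw1
    have h1 : 1 - w ≠ 0 := sub_ne_zero.2 hw1.symm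
    have hab' : a - b ≠ 0 := sub_ne_zero.2 hab
    simp only [T, mem_compl_iff, mem_insert_iff, mem_singleton_iff, not_or]
    constructor
    · intro h
      rw [div_eq_iff h1] at h
      have : w * (a - b) = 0 := by linear_combination h
      simp_all
    · intro h
      rw [div_eq_iff h1] at h
      apply hab'
      linear_combination h
  have hhc : ContinuousOn h {0}ᶜ := by
    intro w hw
    have hw : w ≠ 0 := hw
    apply ContinuousAt.continuousWithinAt
    by_cases hw1 : w = 1
    · subst hw1
      refine (continuousAt_const (y := (1 : ℂ))).congr ?_
      have hlim : Tendsto (fun w : ℂ => ‖T w‖) (𝓝[≠] 1) atTop := by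
        have e1 : Tendsto (fun w : ℂ => 1 - w) (𝓝[≠] 1) (𝓝[≠] 0) := by
          refine tendsto_nhdsWithin_iff.2 ⟨?_, ?_⟩
          · have : Tendsto (fun w : ℂ => 1 - w) (𝓝 1) (𝓝 (1 - 1)) :=
              (continuous_const.sub continuous_id).tendsto 1
            rw [sub_self] at this
            exact this.mono_left nhdsWithin_le_nhds
          · filter_upwards [self_mem_nhdsWithin] with w hw
            have hw : w ≠ 1 := hw
            exact sub_ne_zero.2 hw.symm
        have e2 : Tendsto (fun w : ℂ => ‖(1 - w)⁻¹‖) (𝓝[≠] 1) atTop :=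
          tendsto_norm_cobounded_atTop.comp (tendsto_inv₀_nhdsNE_zero.comp e1)
        have e3 : Tendsto (fun w : ℂ => ‖a - b‖ * ‖(1 - w)⁻¹‖ - ‖b‖) (𝓝[≠] 1) atTop :=
          tendsto_atTop_add_const_right _ _
            (e2.const_mul_atTop (norm_pos_iff.2 (sub_ne_zero.2 hab)))
        refine tendsto_atTop_mono' _ ?_ e3
        filter_upwards [self_mem_nhdsWithin] with w hw
        have hw : w ≠ 1 := hw
        have h1 : 1 - w ≠ 0 := sub_ne_zero.2 hw.symm
        have : T w = b + (a - b) * (1 - w)⁻¹ := by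
          simp only [T]
          field_simp
          ring
        rw [this, ← norm_mul]
        have := norm_sub_le (b + (a - b) * (1 - w)⁻¹) b
        simp only [add_sub_cancel_left] at this
        linarith
      have := hlim.eventually_gt_atTop R
      rw [eventually_nhdsWithin_iff] at this
      filter_upwards [this] with w hw
      by_cases hw0 : w = 1
      · simp [h, hw0]
      · simp only [h, hw0, if_false]
        exact (hR _ (hw hw0)).symm
    · have hgc : ContinuousAt g (T w) := hg.continuousAt
        (((finite_singleton b).insert a).isClosed.isOpen_compl.mem_nhds (hT w hw hw1))
      have hTc : ContinuousAt T w := by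
        refine ContinuousAt.div (by fun_prop) (by fun_prop) (sub_ne_zero.2 (Ne.symm hw1))
      have : ContinuousAt (fun w => g (T w)) w := ContinuousAt.comp (f := T) hgc hTc
      refine this.congr ?_
      filter_upwards [isOpen_compl_singleton.mem_nhds hw1] with v hv
      simp only [mem_compl_iff, mem_singleton_iff] at hv
      simp [h, hv]
  have hh0 : ∀ w, h w ≠ 0 := by
    intro w
    by_cases hw : w = 1
    · simp [h, hw]
    · simpa [h, hw] using h0 _
  have hcomp : Continuous (fun ζ => h (Complex.exp ζ)) := by
    rw [← continuousOn_univ]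
    exact hhc.comp Complex.continuous_exp.continuousOn (fun ζ _ => Complex.exp_ne_zero ζ)
  obtain ⟨L, hL, hLe⟩ := exists_continuous_log hcomp (fun ζ => hh0 _)
  have hone : ∀ ζ, Complex.exp (L (ζ + 2 * Real.pi * Complex.I) - L ζ) = 1 := by
    intro ζ
    rw [Complex.exp_sub, hLe, hLe, Complex.exp_periodic]
    exact div_self (hh0 _)
  -- `m` is the winding number; it does not depend on the base point because the increment of `L`
  -- over a period is continuous with values in 2πiℤ.
  obtain ⟨m, hm⟩ := Complex.exp_eq_one_iff.1 (hone 0)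
  refine ⟨L, m, hL, ?_, ?_⟩
  · intro ζ
    have := eq_of_exp_eq_one (f := fun ζ => L (ζ + 2 * Real.pi * Complex.I) - L ζ)
      isPreconnected_univ (by fun_prop) (fun z _ => hone z) (mem_univ ζ) (mem_univ 0)
    rw [hm] at this
    linear_combination this
  · intro ζ z hza hzb hζ
    have h1 : z - b ≠ 0 := sub_ne_zero.2 hzb
    have hab' : a - b ≠ 0 := sub_ne_zero.2 hab
    have hne : (z - a) / (z - b) ≠ 1 := by
      rw [ne_eq, div_eq_one_iff_eq h1]
      intro h
      apply hab
      linear_combination -h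
    have hTz : T ((z - a) / (z - b)) = z := by
      simp only [T]
      rw [div_eq_iff (sub_ne_zero.2 hne.symm)]
      field_simp
      ring
    rw [hLe, hζ]
    simp [h, hne, hTz]

/-- Two nonvanishing functions on the complement of two points that equal one near infinity are
multiplicatively dependent up to exponentials. -/
theorem exists_log_compl_pair {g₁ g₂ : ℂ → ℂ} {a b : ℂ} (hab : a ≠ b)
    (hg₁ : ContinuousOn g₁ {a, b}ᶜ) (h₁ : ∀ z, g₁ z ≠ 0)
    (hg₂ : ContinuousOn g₂ {a, b}ᶜ) (h₂ : ∀ z, g₂ z ≠ 0) {R : ℝ}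
    (hR₁ : ∀ z : ℂ, R < ‖z‖ → g₁ z = 1) (hR₂ : ∀ z : ℂ, R < ‖z‖ → g₂ z = 1) :
    ∃ (p q : ℤ) (t : ℂ → ℂ), ¬ (p = 0 ∧ q = 0) ∧ ContinuousOn t {a, b}ᶜ ∧
      ∀ z ∈ ({a, b} : Set ℂ)ᶜ, Complex.exp (t z) = g₁ z ^ p * g₂ z ^ q := by
  obtain ⟨L₁, m₁, hL₁, hp₁, he₁⟩ := exists_log_lift_compl_pair hab hg₁ h₁ hR₁
  obtain ⟨L₂, m₂, hL₂, hp₂, he₂⟩ := exists_log_lift_compl_pair hab hg₂ h₂ hR₂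
  -- With this choice the winding numbers of the two factors cancel, so the combined logarithm is
  -- periodic and descends.
  obtain ⟨p, q, hpq, hm⟩ : ∃ p q : ℤ, ¬ (p = 0 ∧ q = 0) ∧ p * m₁ + q * m₂ = 0 := by
    by_cases h : m₁ = 0 ∧ m₂ = 0
    · exact ⟨1, 0, by simp, by simp [h]⟩
    · exact ⟨m₂, -m₁, by simpa [and_comm] using h, by ring⟩
  have hm' : (p * m₁ + q * m₂ : ℂ) = 0 := by exact_mod_cast hm
  let M : ℂ → ℂ := fun ζ => p * L₁ ζ + q * L₂ ζ
  have hM : Continuous M := by fun_prop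
  have hper : Function.Periodic M (2 * Real.pi * Complex.I) := by
    intro ζ
    simp only [M, hp₁, hp₂]
    linear_combination (2 * Real.pi * Complex.I) * hm'
  refine ⟨p, q, fun z => M (Complex.log ((z - a) / (z - b))), hpq, ?_, ?_⟩
  · refine (continuousOn_comp_log hM hper).comp (f := fun z => (z - a) / (z - b)) ?_ ?_
    · refine ContinuousOn.div (by fun_prop) (by fun_prop) ?_
      intro z hz
      simp at hz
      exact sub_ne_zero.2 hz.2
    · intro z hz
      simp at hz
      simpa using div_ne_zero (sub_ne_zero.2 hz.1) (sub_ne_zero.2 hz.2)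
  · intro z hz
    simp at hz
    have hlog := Complex.exp_log (div_ne_zero (sub_ne_zero.2 hz.1) (sub_ne_zero.2 hz.2))
    simp only [M]
    rw [Complex.exp_add, Complex.exp_int_mul, Complex.exp_int_mul, he₁ _ z hz.1 hz.2 hlog,
      he₂ _ z hz.1 hz.2 hlog]

/-! ### Janiszewski-type theorems -/

theorem eventually_linked_iff {U : Set ℂ} (hU : IsOpen U) {x z : ℂ} (hz : z ∈ U) :
    ∀ᶠ w in 𝓝 z, (Linked U x w ↔ Linked U x z) := by
  filter_upwards [hU.connectedComponentIn.mem_nhds (mem_connectedComponentIn hz)] with w hw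
  have h : Linked U z w := Linked.iff_mem_component.2 ⟨hz, hw⟩
  exact ⟨fun h' => h'.trans h.symm, fun h' => h'.trans h⟩

/-- The exterior of a large disc is connected and misses Z. Subtracting the constant makes
coboundaries equal to 1 near infinity, as the logarithm lemmas require. -/
theorem exists_eq_of_norm_gt {Z : Set ℂ} (hZ : IsCompact Z) {c : ℂ → ℤ}
    (hc : ∀ z ∉ Z, ∀ᶠ w in 𝓝 z, c w = c z) :
    ∃ (k : ℤ) (R : ℝ), ∀ z : ℂ, R < ‖z‖ → c z = k := by
  obtain ⟨R, hR0, hR⟩ := hZ.isBounded.exists_pos_norm_le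
  have hcont : ContinuousOn c {z : ℂ | R < ‖z‖} := by
    intro z hz
    apply ContinuousAt.continuousWithinAt
    have hzZ : z ∉ Z := fun h => not_lt.2 (hR z h) hz
    exact (continuousAt_const (y := c z)).congr ((hc z hzZ).mono fun w hw => hw.symm)
  refine ⟨c ((R + 1 : ℝ) : ℂ), R, fun z hz =>
    (isPreconnected_norm_gt R hR0).constant hcont hz ?_⟩
  change R < ‖((R + 1 : ℝ) : ℂ)‖
  rw [Complex.norm_real, Real.norm_of_nonneg (by linarith)]
  linarith

/-- The indicator function of a component, shifted by a constant so as to vanish near infinity. -/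
theorem exists_normalized_indicator {Z : Set ℂ} (hZ : IsCompact Z) (x : ℂ) :
    ∃ (c : ℂ → ℤ) (R : ℝ), (∀ z ∉ Z, ∀ᶠ w in 𝓝 z, c w = c z) ∧
      (∀ z : ℂ, R < ‖z‖ → c z = 0) ∧
      ∃ k : ℤ, (∀ z, Linked Zᶜ x z → c z = k + 1) ∧ ∀ z, ¬ Linked Zᶜ x z → c z = k := by
  classical
  let c : ℂ → ℤ := fun z => if Linked Zᶜ x z then 1 else 0
  have hc : ∀ z ∉ Z, ∀ᶠ w in 𝓝 z, c w = c z := by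
    intro z hz
    filter_upwards [eventually_linked_iff (x := x) hZ.isClosed.isOpen_compl hz] with w hw
    simp [c, hw]
  obtain ⟨k, R, hk⟩ := exists_eq_of_norm_gt hZ hc
  refine ⟨fun z => c z - k, R, ?_, ?_, -k, ?_, ?_⟩
  · intro z hz
    filter_upwards [hc z hz] with w hw
    rw [hw]
  · intro z hz
    simp [hk z hz]
  · intro z hz
    simp only [c, hz, if_true]
    ring
  · intro z hz
    simp [c, hz]

/-- Janiszewski's theorem for compact sets that meet in one point. -/
theorem linked_compl_union {X Y : Set ℂ} (hX : IsCompact X) (hY : IsCompact Y) {p : ℂ}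
    (hXY : X ∩ Y = {p}) {x y : ℂ} (h : Linked Xᶜ x y) (h' : Linked Yᶜ x y) :
    Linked (X ∪ Y)ᶜ x y := by
  by_contra hn
  have hp : p ∈ X ∩ Y := hXY ▸ mem_singleton p
  obtain ⟨c, R, hc, hR, k, hk1, hk0⟩ := exists_normalized_indicator (hX.union hY) x
  obtain ⟨ρ, hρ, h1, h0⟩ := exists_bump hX.isClosed hY.isClosed ⟨p, hp.1⟩ ⟨p, hp.2⟩
  have hg := coboundary_continuousOn hX.isClosed hY.isClosed hc hρ h1 h0
  obtain ⟨t, ht, hte⟩ := exists_log_compl_singleton (p := p) (R := R) (by rwa [← hXY])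
    (coboundary_ne_zero c ρ) (fun z hz => by simp [coboundary, hR z hz])
  -- The logarithm would force the indicator of the component of x to agree at x and y, although y
  -- lies outside that component.
  have := eq_of_coboundary_eq_exp hX.isClosed hY.isClosed hc hρ h1 h0 (t := t) (by rwa [hXY])
    (fun z hz => hte z (by rw [hXY] at hz; simpa using hz)) h h'
  have hx : Linked (X ∪ Y)ᶜ x x := Linked.refl (by
    have := h.left_mem
    have := h'.left_mem
    simp_all)
  rw [hk1 x hx, hk0 y hn] at this
  omega

/-- The coboundary turns sums into products, so a logarithm of the product is one for a single
integer function. -/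
theorem coboundary_combination (c₁ c₂ : ℂ → ℤ) (ρ : ℂ → ℝ) (p q : ℤ) (z : ℂ) :
    coboundary c₁ ρ z ^ p * coboundary c₂ ρ z ^ q =
      coboundary (fun z => p * c₁ z + q * c₂ z) ρ z := by
  simp only [coboundary, ← Complex.exp_int_mul, ← Complex.exp_add]
  push_cast
  ring_nf

/-- The union of two compact sets that meet in two points separates at most two of the points
that neither set separates. -/
theorem linked_of_inter_eq_pair {X Y : Set ℂ} (hX : IsCompact X) (hY : IsCompact Y) {a b : ℂ}
    (hab : a ≠ b) (hXY : X ∩ Y = {a, b}) {x y z : ℂ} (hx : Linked Xᶜ x y) (hx' : Linked Yᶜ x y)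
    (hy : Linked Xᶜ x z) (hy' : Linked Yᶜ x z) :
    Linked (X ∪ Y)ᶜ x y ∨ Linked (X ∪ Y)ᶜ x z ∨ Linked (X ∪ Y)ᶜ y z := by
  by_contra! hn
  obtain ⟨n1, n2, n3⟩ := hn
  have ha : a ∈ X ∩ Y := hXY ▸ mem_insert a {b}
  obtain ⟨c₁, R₁, hc₁, hR₁, k₁, hk1, hk1'⟩ := exists_normalized_indicator (hX.union hY) x
  obtain ⟨c₂, R₂, hc₂, hR₂, k₂, hk2, hk2'⟩ := exists_normalized_indicator (hX.union hY) y
  obtain ⟨ρ, hρ, h1, h0⟩ := exists_bump hX.isClosed hY.isClosed ⟨a, ha.1⟩ ⟨a, ha.2⟩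
  have hg₁ := coboundary_continuousOn hX.isClosed hY.isClosed hc₁ hρ h1 h0
  have hg₂ := coboundary_continuousOn hX.isClosed hY.isClosed hc₂ hρ h1 h0
  obtain ⟨p, q, t, hpq, ht, hte⟩ := exists_log_compl_pair (R := max R₁ R₂) hab
    (by rwa [← hXY]) (coboundary_ne_zero c₁ ρ) (by rwa [← hXY]) (coboundary_ne_zero c₂ ρ)
    (fun z hz => by simp [coboundary, hR₁ z ((le_max_left _ _).trans_lt hz)])
    (fun z hz => by simp [coboundary, hR₂ z ((le_max_right _ _).trans_lt hz)])
  have hc : ∀ z ∉ X ∪ Y, ∀ᶠ w in 𝓝 z, p * c₁ w + q * c₂ w = p * c₁ z + q * c₂ z := by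
    intro z hz
    filter_upwards [hc₁ z hz, hc₂ z hz] with w hw hw'
    rw [hw, hw']
  have key := fun {u v : ℂ} => eq_of_coboundary_eq_exp (x := u) (y := v) hX.isClosed hY.isClosed
    hc hρ h1 h0 (t := t) (by rwa [hXY])
    (fun z hz => by rw [hte z (by rwa [← hXY]), coboundary_combination])
  have hxx : Linked (X ∪ Y)ᶜ x x := Linked.refl (by
    have := hx.left_mem
    have := hx'.left_mem
    simp_all)
  have hyy : Linked (X ∪ Y)ᶜ y y := Linked.refl (by
    have := hx.right_mem
    have := hx'.right_mem
    simp_all)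
  have e1 := key hx hx'
  have e2 := key hy hy'
  rw [hk1 x hxx, hk2' x (fun h => n1 h.symm), hk1' y n1, hk2 y hyy] at e1
  rw [hk1 x hxx, hk2' x (fun h => n1 h.symm), hk1' z n2, hk2' z n3] at e2
  -- Comparing x with z gives p = 0, comparing x with y gives p = q.
  have hp0 : p = 0 := by linarith
  have hq0 : q = 0 := by subst hp0; linarith
  exact hpq ⟨hp0, hq0⟩

/-! ### Arcs neither separate the plane nor have interior -/

theorem exists_compact_of_ne {p x y : ℂ} (hx : x ≠ p) (hy : y ≠ p) :
    ∃ C : Set ℂ, IsCompact C ∧ IsPreconnected C ∧ x ∈ C ∧ y ∈ C ∧ p ∉ C := by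
  have h := isPathConnected_compl_singleton_of_one_lt_rank
    (by rw [Complex.rank_real_complex]; norm_num) p
  have hj := h.joinedIn x hx y hy
  let σ := hj.somePath
  refine ⟨range σ, isCompact_range σ.continuous, isPreconnected_range σ.continuous,
    ⟨0, σ.source⟩, ⟨1, σ.target⟩, ?_⟩
  rintro ⟨t, ht⟩
  exact hj.somePath_mem t ht

theorem image_Icc_union {γ : ℝ → ℂ} {s r t : ℝ} (hsr : s ≤ r) (hrt : r ≤ t) :
    γ '' Icc s t = γ '' Icc s r ∪ γ '' Icc r t := by
  rw [← image_union, Icc_union_Icc_eq_Icc hsr hrt]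

theorem image_Icc_inter {γ : ℝ → ℂ} {s r t : ℝ} (hγ : InjOn γ (Icc s t)) (hsr : s ≤ r)
    (hrt : r ≤ t) : γ '' Icc s r ∩ γ '' Icc r t = {γ r} := by
  rw [← hγ.image_inter (Icc_subset_Icc_right hrt) (Icc_subset_Icc_left hsr),
    Icc_inter_Icc_eq_singleton hsr hrt, image_singleton]

/-- An arc does not separate the plane. -/
theorem linked_compl_arc {γ : ℝ → ℂ} (hc : Continuous γ) {s t : ℝ} (hst : s ≤ t)
    (hγ : InjOn γ (Icc s t)) {x y : ℂ} (hx : x ∉ γ '' Icc s t) (hy : y ∉ γ '' Icc s t) :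
    Linked (γ '' Icc s t)ᶜ x y := by
  have hC : ∀ r : Icc s t, ∃ C : Set ℂ, IsCompact C ∧ IsPreconnected C ∧ x ∈ C ∧ y ∈ C ∧
      γ r ∉ C := fun r => exists_compact_of_ne (fun h => hx ⟨r, r.2, h.symm⟩)
        (fun h => hy ⟨r, r.2, h.symm⟩)
  choose C hCc hCp hCx hCy hCr using hC
  have hO : ∀ r : Icc s t, IsOpen ((fun u : Icc s t => γ u) ⁻¹' (C r)ᶜ) := fun r =>
    (hCc r).isClosed.isOpen_compl.preimage (hc.comp continuous_subtype_val)
  -- Each `C r` is compact and misses `γ r`, hence a whole stretch of the arc. Finitely many such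
  -- stretches suffice, and they are attached one at a time, each meeting the previous ones in one
  -- point.
  obtain ⟨τ, h0, hmono, ⟨m, hm⟩, hτ⟩ := exists_monotone_Icc_subset_open_cover_Icc hst hO
    (fun r _ => mem_iUnion.2 ⟨r, hCr r⟩)
  have key : ∀ n, Linked (γ '' Icc s (τ n))ᶜ x y := by
    intro n
    induction n with
    | zero =>
      rw [h0]
      refine (hCp ⟨s, left_mem_Icc.2 hst⟩).linked ?_ (hCx _) (hCy _)
      simpa using hCr ⟨s, left_mem_Icc.2 hst⟩
    | succ n ih =>
      have h1 : s ≤ τ n := (τ n).2.1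
      have h2 : (τ n : ℝ) ≤ τ (n + 1) := hmono (Nat.le_succ n)
      have h3 : (τ (n + 1) : ℝ) ≤ t := (τ (n + 1)).2.2
      rw [image_Icc_union h1 h2]
      refine linked_compl_union (isCompact_Icc.image hc) (isCompact_Icc.image hc)
        (image_Icc_inter (hγ.mono (Icc_subset_Icc_right h3)) h1 h2) ih ?_
      obtain ⟨r, hr⟩ := hτ n
      refine (hCp r).linked ?_ (hCx r) (hCy r)
      rintro _ hz ⟨u, hu, rfl⟩
      have hu' : u ∈ Icc s t := ⟨h1.trans hu.1, hu.2.trans h3⟩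
      exact hr (show (⟨u, hu'⟩ : Icc s t) ∈ Icc (τ n) (τ (n + 1)) from hu) hz
  have := key m
  rwa [hm m le_rfl] at this

theorem isPreconnected_ball_diff_center (x : ℂ) {r : ℝ} (hr : 0 < r) :
    IsPreconnected (Metric.ball x r \ {x}) := by
  have h : Metric.ball x r \ {x} = (fun w => x + Complex.exp w) '' {z : ℂ | z.re < Real.log r} := by
    ext z
    simp only [Set.mem_sdiff, Metric.mem_ball, mem_singleton_iff, mem_image, mem_ofPred_eq,
      dist_eq_norm]
    constructor
    · rintro ⟨hz, hne⟩
      have hz0 : z - x ≠ 0 := sub_ne_zero.2 hne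
      refine ⟨Complex.log (z - x), ?_, by rw [Complex.exp_log hz0]; ring⟩
      rw [Complex.log_re]
      exact Real.log_lt_log (norm_pos_iff.2 hz0) hz
    · rintro ⟨w, hw, rfl⟩
      simp only [add_sub_cancel_left, Complex.norm_exp, add_eq_left]
      exact ⟨(Real.lt_log_iff_exp_lt hr).1 hw, Complex.exp_ne_zero _⟩
  rw [h]
  exact ((convex_halfSpace_re_lt _).isPreconnected).image _ (by fun_prop)

/-- An arc has empty interior. -/
theorem not_subset_arc {γ : ℝ → ℂ} (hc : Continuous γ) {s t : ℝ}
    (hγ : InjOn γ (Icc s t)) {O : Set ℂ} (hO : IsOpen O) (hne : O.Nonempty) :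
    ¬ O ⊆ γ '' Icc s t := by
  intro hsub
  have hfin : ({γ s, γ t} : Set ℂ).Finite := (finite_singleton _).insert _
  have hO' : IsOpen (O \ {γ s, γ t}) := hO.sdiff hfin.isClosed
  obtain ⟨x, hxO, hx⟩ : (O \ {γ s, γ t}).Nonempty := by
    have hd : Dense ({γ s, γ t} : Set ℂ)ᶜ := hfin.countable.dense_compl ℝ
    exact hd.inter_open_nonempty O hO hne
  obtain ⟨r, hr, rfl⟩ := hsub hxO
  obtain ⟨ε, hε, hball⟩ := Metric.isOpen_iff.1 hO' _ ⟨hxO, hx⟩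
  have hsr : s < r := lt_of_le_of_ne hr.1 (by rintro rfl; simp at hx)
  have hrt : r < t := lt_of_le_of_ne hr.2 (by rintro rfl; simp at hx)
  obtain ⟨δ, hδ, hδ'⟩ := Metric.isOpen_iff.1 (Metric.isOpen_ball.preimage hc) r
    (show γ r ∈ Metric.ball (γ r) ε by simpa using hε)
  obtain ⟨η, hη0, hη1, hη2, hη3⟩ : ∃ η > 0, η < δ ∧ η < r - s ∧ η < t - r := by
    refine ⟨min δ (min (r - s) (t - r)) / 2, ?_, ?_, ?_, ?_⟩
    · have : 0 < min δ (min (r - s) (t - r)) := by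
        simp only [lt_min_iff]
        exact ⟨hδ, by linarith, by linarith⟩
      linarith
    all_goals
      have h1 := min_le_left δ (min (r - s) (t - r))
      have h2 := min_le_right δ (min (r - s) (t - r))
      have h3 := min_le_left (r - s) (t - r)
      have h4 := min_le_right (r - s) (t - r)
      have : 0 < min δ (min (r - s) (t - r)) := by
        simp only [lt_min_iff]
        exact ⟨hδ, by linarith, by linarith⟩
      linarith
  have hL : γ (r - η) ∈ Metric.ball (γ r) ε \ {γ r} := by
    refine ⟨hδ' (by simp [abs_of_pos hη0, hη1]), fun h => ?_⟩
    have := hγ ⟨by linarith, by linarith⟩ hr h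
    linarith
  have hR : γ (r + η) ∈ Metric.ball (γ r) ε \ {γ r} := by
    refine ⟨hδ' (by simp [abs_of_pos hη0, hη1]), fun h => ?_⟩
    have := hγ ⟨by linarith, by linarith⟩ hr h
    linarith
  -- A punctured disc is connected, but an interior point of the arc cuts it into two closed pieces
  -- that meet only in the puncture.
  have hcl := isPreconnected_closed_iff.1 (isPreconnected_ball_diff_center (γ r) hε)
    (γ '' Icc s r) (γ '' Icc r t) (isCompact_Icc.image hc).isClosed
    (isCompact_Icc.image hc).isClosed (by
      rw [← image_Icc_union hr.1 hr.2]
      exact (sdiff_subset.trans hball).trans (sdiff_subset.trans hsub))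
    ⟨_, hL, r - η, ⟨by linarith, by linarith⟩, rfl⟩ ⟨_, hR, r + η, ⟨by linarith, by linarith⟩, rfl⟩
  rw [image_Icc_inter hγ hr.1 hr.2] at hcl
  obtain ⟨z, hz, hz'⟩ := hcl
  exact hz.2 hz'

/-! ### Crosscuts and the regions they bound -/

/-- A path in a closed set gives a logarithm on its complement. -/
theorem exists_log_of_path {K : Set ℂ} (σ : C(unitInterval, ℂ)) (hσ : ∀ t, σ t ∈ K) :
    ∃ L : ℂ → ℂ, ContinuousOn L Kᶜ ∧
      ∀ z ∈ Kᶜ, Complex.exp (L z) = (z - σ 0) / (z - σ 1) := by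
  classical
  have hne : ∀ (t : unitInterval) (z : (Kᶜ : Set ℂ)), (z : ℂ) - σ t ≠ 0 := fun t z h => by
    rw [sub_eq_zero] at h
    exact z.2 (h ▸ hσ t)
  -- The pole moves along the path. At time 0 the function is constantly 1, with logarithm 0, and
  -- the lifted homotopy ends in the desired logarithm.
  let H : C(unitInterval × (Kᶜ : Set ℂ), {z : ℂ // z ≠ 0}) :=
    ⟨fun q => ⟨((q.2 : ℂ) - σ 0) / ((q.2 : ℂ) - σ q.1), div_ne_zero (hne _ _) (hne _ _)⟩, by
      refine Continuous.subtype_mk (Continuous.div (by fun_prop) (by fun_prop) ?_) _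
      intro q
      exact hne _ _⟩
  have H0 : ∀ z, H (0, z) = ⟨Complex.exp ((ContinuousMap.const (Kᶜ : Set ℂ) (0 : ℂ)) z),
      Complex.exp_ne_zero _⟩ := by
    intro z
    apply Subtype.ext
    simp [H, div_self (hne 0 z)]
  let F := Complex.isCoveringMap_exp.liftHomotopy H (ContinuousMap.const _ 0) H0
  have hF := Complex.isCoveringMap_exp.liftHomotopy_lifts H (ContinuousMap.const _ 0) H0
  refine ⟨fun z => if hz : z ∈ Kᶜ then F (1, ⟨z, hz⟩) else 0, ?_, ?_⟩
  · rw [continuousOn_iff_continuous_domRestrict]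
    have : Continuous (fun z : (Kᶜ : Set ℂ) => F (1, z)) := by fun_prop
    convert this using 2 with z
    simp only [domRestrict_apply]
    rw [dif_pos z.2]
  · intro z hz
    have := congrArg Subtype.val (congrFun hF (1, ⟨z, hz⟩))
    simp only [hz, dif_pos]
    exact this

/-- After the substitution (z - a)/(z - b) = exp ζ on a half-plane, `L` minus ζ would be constant,
although the substitution has period 2πi and ζ does not. -/
theorem not_exists_log_compl_pair {a b : ℂ} (hab : a ≠ b) {L : ℂ → ℂ}
    (hL : ContinuousOn L {a, b}ᶜ)
    (h : ∀ z ∈ ({a, b} : Set ℂ)ᶜ, Complex.exp (L z) = (z - a) / (z - b)) : False := by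
  let S : Set ℂ := {ζ : ℂ | 0 < ζ.re}
  let T : ℂ → ℂ := fun ζ => (a - b * Complex.exp ζ) / (1 - Complex.exp ζ)
  have hne : ∀ ζ ∈ S, 1 - Complex.exp ζ ≠ 0 := by
    intro ζ hζ h
    have h1 : ‖Complex.exp ζ‖ = 1 := by rw [← sub_eq_zero.1 h]; simp
    rw [Complex.norm_exp] at h1
    have : (0 : ℝ) < ζ.re := hζ
    have := Real.add_one_lt_exp this.ne'
    linarith
  have hab' : a - b ≠ 0 := sub_ne_zero.2 hab
  have hTa : ∀ ζ ∈ S, T ζ - a = Complex.exp ζ * (a - b) / (1 - Complex.exp ζ) := by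
    intro ζ hζ
    have := hne ζ hζ
    simp only [T]
    field_simp
    ring
  have hTb : ∀ ζ ∈ S, T ζ - b = (a - b) / (1 - Complex.exp ζ) := by
    intro ζ hζ
    have := hne ζ hζ
    simp only [T]
    field_simp
    ring
  have hT : ∀ ζ ∈ S, T ζ ∈ ({a, b} : Set ℂ)ᶜ := by
    intro ζ hζ
    simp only [mem_compl_iff, mem_insert_iff, mem_singleton_iff, not_or]
    constructor
    · rw [← sub_eq_zero, hTa ζ hζ]
      exact div_ne_zero (mul_ne_zero (Complex.exp_ne_zero _) hab') (hne ζ hζ)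
    · rw [← sub_eq_zero, hTb ζ hζ]
      exact div_ne_zero hab' (hne ζ hζ)
  have hTc : ContinuousOn T S := ContinuousOn.div (by fun_prop) (by fun_prop) hne
  have hS : IsPreconnected S := (convex_halfSpace_re_gt 0).isPreconnected
  have e := eq_of_exp_eq_one hS (f := fun ζ => L (T ζ) - ζ)
    ((hL.comp hTc hT).sub continuousOn_id) (fun ζ hζ => by
      rw [Complex.exp_sub, h _ (hT ζ hζ), hTa ζ hζ, hTb ζ hζ]
      have := hne ζ hζ
      have := Complex.exp_ne_zero ζ
      field_simp) (x := 1) (y := 1 + 2 * Real.pi * Complex.I) (by simp [S]) (by simp [S])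
  have hTT : T (1 + 2 * Real.pi * Complex.I) = T 1 := by
    simp only [T, Complex.exp_periodic (1 : ℂ)]
  rw [hTT] at e
  apply Complex.two_pi_I_ne_zero
  linear_combination e

/-- A crosscut of a face whose ends are joined in the boundary separates the face. -/
theorem exists_not_linked_of_path {K : Set ℂ} (hK : IsClosed K) {γ : ℝ → ℂ} (hc : Continuous γ)
    (hγ : InjOn γ (Icc 0 1)) (σ : C(unitInterval, ℂ)) (hσ : ∀ t, σ t ∈ K) (h0 : σ 0 = γ 0)
    (h1 : σ 1 = γ 1) {x₀ : ℂ} (hF : γ '' Ioo 0 1 ⊆ connectedComponentIn Kᶜ x₀) :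
    ∃ x ∈ connectedComponentIn Kᶜ x₀ \ γ '' Icc 0 1, ∃ y ∈ connectedComponentIn Kᶜ x₀ \ γ '' Icc 0 1,
      ¬ Linked (K ∪ γ '' Icc 0 1)ᶜ x y := by
  classical
  by_contra! hcon
  set F := connectedComponentIn Kᶜ x₀ with hFdef
  set A := γ '' Icc 0 1 with hA
  have hFo : IsOpen F := hK.isOpen_compl.connectedComponentIn
  have hFK : F ⊆ Kᶜ := connectedComponentIn_subset _ _
  have hFne : F.Nonempty := ⟨γ (1 / 2), hF ⟨1 / 2, by norm_num, rfl⟩⟩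
  obtain ⟨x, hxF, hxA⟩ : (F \ A).Nonempty := by
    rw [sdiff_nonempty]
    exact not_subset_arc hc hγ hFo hFne
  have hab : γ 0 ≠ γ 1 := fun h => by
    have := hγ (by simp) (by simp) h
    norm_num at this
  obtain ⟨LU, hLU, hLUe⟩ := exists_log_of_path (K := K) σ hσ
  obtain ⟨LV, hLV, hLVe⟩ := exists_log_of_path (K := A)
    ⟨fun t : unitInterval => γ t, hc.comp continuous_subtype_val⟩ (fun t => ⟨t, t.2, rfl⟩)
  simp only [ContinuousMap.coe_mk, Icc.coe_zero, Icc.coe_one, h0, h1] at hLUe hLVe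
  have hAc : IsClosed A := (isCompact_Icc.image hc).isClosed
  have hn : ∀ y ∈ F \ A, LU x - LV x = LU y - LV y := by
    intro y hy
    obtain ⟨C, hC, hCp, hCx, hCy⟩ := hcon x ⟨hxF, hxA⟩ y hy
    refine eq_of_exp_eq_one hCp (f := fun z => LU z - LV z) ((hLU.mono ?_).sub (hLV.mono ?_)) ?_
      hCx hCy
    · exact hC.trans (compl_subset_compl.2 subset_union_left)
    · exact hC.trans (compl_subset_compl.2 subset_union_right)
    · intro z hz
      have := hC hz
      simp only [compl_union, mem_inter_iff] at this
      rw [Complex.exp_sub, hLUe z this.1, hLVe z this.2, div_self]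
      rw [← hLVe z this.2]
      exact Complex.exp_ne_zero _
  have hxn : Complex.exp (LU x - LV x) = 1 := by
    rw [Complex.exp_sub, hLUe x (hFK hxF), hLVe x hxA, div_self]
    rw [← hLVe x hxA]
    exact Complex.exp_ne_zero _
  have hcase : ∀ z ∈ ({γ 0, γ 1} : Set ℂ)ᶜ, z ∉ F → z ∈ Aᶜ := by
    rintro z hz hzF ⟨t, ht, rfl⟩
    apply hzF
    refine hF ⟨t, ⟨lt_of_le_of_ne ht.1 ?_, lt_of_le_of_ne ht.2 ?_⟩, rfl⟩
    · rintro rfl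
      simp at hz
    · rintro rfl
      simp at hz
  -- If nothing in F off A is separated, the logarithms off K and off A differ there by a constant.
  -- They then glue to a logarithm off the two ends, because A lies in F apart from its ends.
  refine not_exists_log_compl_pair hab (L := fun z => if z ∈ F then LU z
    else LV z + (LU x - LV x)) ?_ ?_
  · intro z hz
    apply ContinuousAt.continuousWithinAt
    by_cases hzF : z ∈ F
    · have : ContinuousAt LU z := hLU.continuousAt (hK.isOpen_compl.mem_nhds (hFK hzF))
      refine this.congr ?_
      filter_upwards [hFo.mem_nhds hzF] with w hw
      simp [hw]
    · have hzA := hcase z hz hzF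
      have : ContinuousAt LV z := hLV.continuousAt (hAc.isOpen_compl.mem_nhds hzA)
      refine (this.add_const (LU x - LV x)).congr ?_
      filter_upwards [hAc.isOpen_compl.mem_nhds hzA] with w hw
      by_cases hwF : w ∈ F
      · simp only [hwF, if_true]
        rw [hn w ⟨hwF, hw⟩]
        ring
      · simp [hwF]
  · intro z hz
    by_cases hzF : z ∈ F
    · simp only [hzF, if_true]
      exact hLUe z (hFK hzF)
    · simp only [hzF, if_false]
      rw [Complex.exp_add, hxn, mul_one]
      exact hLVe z (hcase z hz hzF)

/-- Every interior point of an arc lies on the boundary of each region that the arc separates from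
another one. -/
theorem mem_closure_of_not_linked {K : Set ℂ} (hK : IsCompact K) {γ : ℝ → ℂ} (hc : Continuous γ)
    (hγ : InjOn γ (Icc 0 1)) (hKγ : K ∩ γ '' Icc 0 1 = {γ 0, γ 1}) {x y : ℂ}
    (hxy : Linked Kᶜ x y) (hx : x ∉ γ '' Icc 0 1) (hy : y ∉ γ '' Icc 0 1)
    (hn : ¬ Linked (K ∪ γ '' Icc 0 1)ᶜ x y) {r : ℝ} (hr : r ∈ Ioo (0 : ℝ) 1) :
    γ r ∈ closure (connectedComponentIn (K ∪ γ '' Icc 0 1)ᶜ x) := by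
  set A := γ '' Icc 0 1 with hA
  set F := connectedComponentIn (K ∪ A)ᶜ x with hF
  have hAc : IsCompact A := isCompact_Icc.image hc
  have hUo : IsOpen (K ∪ A)ᶜ := (hK.union hAc).isClosed.isOpen_compl
  have hFo : IsOpen F := hUo.connectedComponentIn
  have hxU : x ∈ (K ∪ A)ᶜ := by
    have := hxy.left_mem
    simp_all
  have hxF : x ∈ F := mem_connectedComponentIn hxU
  by_contra hcl
  obtain ⟨δ, hδ, hδ'⟩ := Metric.isOpen_iff.1 (isClosed_closure.isOpen_compl.preimage hc) r hcl
  -- A window around r that the closure of F avoids. Removing it leaves two end pieces, each meeting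
  -- K in one point, so K with these pieces does not separate x from y.
  obtain ⟨s, s', hs0, hsr, hrs, hs1, hsδ, hsδ'⟩ : ∃ s s' : ℝ, 0 < s ∧ s < r ∧ r < s' ∧ s' < 1 ∧
      r - δ < s ∧ s' < r + δ := by
    obtain ⟨s, h1, h2⟩ := exists_between (max_lt hr.1 (sub_lt_self r hδ))
    obtain ⟨s', h3, h4⟩ := exists_between (lt_min hr.2 (lt_add_of_pos_right r hδ))
    rw [max_lt_iff] at h1
    rw [lt_min_iff] at h4
    exact ⟨s, s', h1.1, h2, h3, h4.1, h1.2, h4.2⟩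
  have hI1 : Icc 0 s ⊆ Icc (0 : ℝ) 1 := Icc_subset_Icc_right (by linarith)
  have hI2 : Icc s' 1 ⊆ Icc (0 : ℝ) 1 := Icc_subset_Icc_left (by linarith)
  have h0A : γ 0 ∈ K := by
    have : γ 0 ∈ K ∩ A := by rw [hKγ]; simp
    exact this.1
  have h1A : γ 1 ∈ K := by
    have : γ 1 ∈ K ∩ A := by rw [hKγ]; simp
    exact this.1
  have hend : ∀ t ∈ Icc (0 : ℝ) 1, γ t ∈ K → t = 0 ∨ t = 1 := by
    intro t ht htK
    have : γ t ∈ K ∩ A := ⟨htK, t, ht, rfl⟩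
    rw [hKγ] at this
    rcases this with h | h
    · exact Or.inl (hγ ht (by simp) h)
    · exact Or.inr (hγ ht (by simp) h)
  have l1 : Linked (K ∪ γ '' Icc 0 s)ᶜ x y := by
    refine linked_compl_union hK (isCompact_Icc.image hc) (p := γ 0) ?_ hxy
      (linked_compl_arc hc hs0.le (hγ.mono hI1) (fun h => hx (image_mono hI1 h))
        (fun h => hy (image_mono hI1 h)))
    apply Subset.antisymm
    · rintro _ ⟨hzK, t, ht, rfl⟩
      rcases hend t (hI1 ht) hzK with rfl | rfl
      · rfl
      · exact absurd ht.2 (by linarith)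
    · rintro _ rfl
      exact ⟨h0A, 0, ⟨le_rfl, hs0.le⟩, rfl⟩
  have l2 : Linked ((K ∪ γ '' Icc 0 s) ∪ γ '' Icc s' 1)ᶜ x y := by
    refine linked_compl_union (hK.union (isCompact_Icc.image hc)) (isCompact_Icc.image hc)
      (p := γ 1) ?_ l1
      (linked_compl_arc hc hs1.le (hγ.mono hI2) (fun h => hx (image_mono hI2 h))
        (fun h => hy (image_mono hI2 h)))
    apply Subset.antisymm
    · rintro _ ⟨hzK | ⟨u, hu, hut⟩, t, ht, rfl⟩
      · rcases hend t (hI2 ht) hzK with rfl | rfl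
        · exact absurd ht.1 (by linarith)
        · rfl
      · have := hγ (hI1 hu) (hI2 ht) hut
        subst this
        exact absurd ht.1 (by linarith [hu.2])
    · rintro _ rfl
      exact ⟨Or.inl h1A, 1, ⟨hs1.le, le_rfl⟩, rfl⟩
  obtain ⟨C, hC, hCp, hCx, hCy⟩ := l2
  -- The linking set can cross the arc only inside the window, away from the closure of F. It
  -- therefore cannot leave F.
  have hcov : C ⊆ F ∪ (closure F)ᶜ := by
    intro q hq
    by_cases hqF : q ∈ closure F
    · left
      have hqC := hC hq
      simp only [compl_union, mem_inter_iff, mem_compl_iff] at hqC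
      by_cases hqA : q ∈ A
      · exfalso
        obtain ⟨u, hu, rfl⟩ := hqA
        have hu1 : s < u := by
          by_contra! h
          exact hqC.1.2 ⟨u, ⟨hu.1, h⟩, rfl⟩
        have hu2 : u < s' := by
          by_contra! h
          exact hqC.2 ⟨u, ⟨h, hu.2⟩, rfl⟩
        refine hδ' (?_ : u ∈ Metric.ball r δ) hqF
        rw [Real.ball_eq_Ioo]
        exact ⟨by linarith, by linarith⟩
      · have hqU : q ∈ (K ∪ A)ᶜ := by simp [hqA, hqC.1.1]
        obtain ⟨w, hw, hwF⟩ := mem_closure_iff.1 hqF _ hUo.connectedComponentIn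
          (mem_connectedComponentIn hqU)
        rw [hF, connectedComponentIn_eq hwF, ← connectedComponentIn_eq hw]
        exact mem_connectedComponentIn hqU
    · exact Or.inr hqF
  have hsub : C ⊆ F := hCp.subset_left_of_subset_union hFo isClosed_closure.isOpen_compl
    (disjoint_compl_right.mono_left subset_closure) hcov ⟨x, hCx, hxF⟩
  exact hn (Linked.iff_mem_component.2 ⟨hxU, hsub hCy⟩)

/-! ### Components of a complement after adding an arc -/

/-- The connected components of the complement of `K`. -/
def complComponents (K : Set ℂ) : Set (Set ℂ) :=
  {F | ∃ x ∈ Kᶜ, F = connectedComponentIn Kᶜ x}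

theorem eq_of_mem_complComponents {K F F' : Set ℂ} (hF : F ∈ complComponents K)
    (hF' : F' ∈ complComponents K) {x : ℂ} (hx : x ∈ F) (hx' : x ∈ F') : F = F' := by
  obtain ⟨y, -, rfl⟩ := hF
  obtain ⟨y', -, rfl⟩ := hF'
  rw [connectedComponentIn_eq hx, connectedComponentIn_eq hx']

theorem subset_compl_of_mem_complComponents {K F : Set ℂ} (hF : F ∈ complComponents K) :
    F ⊆ Kᶜ := by
  obtain ⟨y, -, rfl⟩ := hF
  exact connectedComponentIn_subset _ _

theorem isOpen_of_mem_complComponents {K F : Set ℂ} (hK : IsClosed K)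
    (hF : F ∈ complComponents K) : IsOpen F := by
  obtain ⟨y, -, rfl⟩ := hF
  exact hK.isOpen_compl.connectedComponentIn

theorem isPreconnected_of_mem_complComponents {K F : Set ℂ}
    (hF : F ∈ complComponents K) : IsPreconnected F := by
  obtain ⟨y, -, rfl⟩ := hF
  exact isPreconnected_connectedComponentIn

theorem nonempty_of_mem_complComponents {K F : Set ℂ} (hF : F ∈ complComponents K) :
    F.Nonempty := by
  obtain ⟨y, hy, rfl⟩ := hF
  exact ⟨y, mem_connectedComponentIn hy⟩

theorem component_mem_complComponents {K : Set ℂ} {x : ℂ} (hx : x ∉ K) :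
    connectedComponentIn Kᶜ x ∈ complComponents K := ⟨x, hx, rfl⟩

/-- A connected set off K cannot cross the frontier of F, so the component around F is no larger. -/
theorem mem_complComponents_of_frontier_subset {K F : Set ℂ} (hF : IsPreconnected F)
    (hFo : IsOpen F) (hne : F.Nonempty) (hFK : F ⊆ Kᶜ) (hfr : frontier F ⊆ K) :
    F ∈ complComponents K := by
  obtain ⟨x, hx⟩ := hne
  refine ⟨x, hFK hx, Subset.antisymm (hF.subset_connectedComponentIn hx hFK) ?_⟩
  refine isPreconnected_connectedComponentIn.subset_left_of_subset_union hFo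
    isClosed_closure.isOpen_compl (disjoint_compl_right.mono_left subset_closure) ?_
    ⟨x, mem_connectedComponentIn (hFK hx), hx⟩
  intro z hz
  by_cases h : z ∈ closure F
  · left
    by_contra hzF
    refine connectedComponentIn_subset _ _ hz (hfr ?_)
    rw [hFo.frontier_eq]
    exact ⟨h, hzF⟩
  · exact Or.inr h

section Arc

variable {K : Set ℂ} {γ : ℝ → ℂ}

theorem eq_endpoint_of_mem (hγ : InjOn γ (Icc 0 1)) (hKγ : K ∩ γ '' Icc 0 1 = {γ 0, γ 1})
    {t : ℝ} (ht : t ∈ Icc (0 : ℝ) 1) (hK : γ t ∈ K) : t = 0 ∨ t = 1 := by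
  have : γ t ∈ K ∩ γ '' Icc 0 1 := ⟨hK, t, ht, rfl⟩
  rw [hKγ] at this
  rcases this with h | h
  · exact Or.inl (hγ ht (by simp) h)
  · exact Or.inr (hγ ht (by simp) h)

theorem image_Ioo_subset_component (hc : Continuous γ) (hγ : InjOn γ (Icc 0 1))
    (hKγ : K ∩ γ '' Icc 0 1 = {γ 0, γ 1}) :
    γ '' Ioo 0 1 ⊆ connectedComponentIn Kᶜ (γ (1 / 2)) := by
  refine (isPreconnected_Ioo.image γ hc.continuousOn).subset_connectedComponentIn
    ⟨1 / 2, by norm_num, rfl⟩ ?_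
  rintro _ ⟨t, ht, rfl⟩ htK
  rcases eq_endpoint_of_mem hγ hKγ (Ioo_subset_Icc_self ht) htK with rfl | rfl
  · exact lt_irrefl _ ht.1
  · exact lt_irrefl _ ht.2

/-- The open arc is connected and misses K, so it lies in a single component; all others survive
unchanged. -/
theorem complComponents_union_arc (hc : Continuous γ)
    (hγ : InjOn γ (Icc 0 1)) (hKγ : K ∩ γ '' Icc 0 1 = {γ 0, γ 1}) :
    complComponents (K ∪ γ '' Icc 0 1) =
      complComponents K \ {connectedComponentIn Kᶜ (γ (1 / 2))} ∪
        (connectedComponentIn (K ∪ γ '' Icc 0 1)ᶜ) ''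
          (connectedComponentIn Kᶜ (γ (1 / 2)) \ γ '' Icc 0 1) := by
  set A := γ '' Icc 0 1 with hA
  set F₀ := connectedComponentIn Kᶜ (γ (1 / 2)) with hF₀
  have hIoo : γ '' Ioo 0 1 ⊆ F₀ := image_Ioo_subset_component hc hγ hKγ
  have hhalf : γ (1 / 2) ∈ F₀ := hIoo ⟨1 / 2, by norm_num, rfl⟩
  have hF₀K : F₀ ⊆ Kᶜ := connectedComponentIn_subset _ _
  have hF₀c : F₀ ∈ complComponents K := component_mem_complComponents (hF₀K hhalf)
  have hAsub : ∀ z ∈ A, z ∉ K → z ∈ F₀ := by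
    rintro _ ⟨t, ht, rfl⟩ htK
    refine hIoo ⟨t, ⟨lt_of_le_of_ne ht.1 ?_, lt_of_le_of_ne ht.2 ?_⟩, rfl⟩
    all_goals
      have : ({γ 0, γ 1} : Set ℂ) ⊆ K := hKγ ▸ inter_subset_left
      rintro rfl
      exact htK (this (by simp))
  have hother : ∀ x ∉ K, x ∉ F₀ →
      connectedComponentIn (K ∪ A)ᶜ x = connectedComponentIn Kᶜ x := by
    intro x hx hxF
    refine Subset.antisymm
      (connectedComponentIn_mono x (compl_subset_compl.2 subset_union_left)) ?_
    refine isPreconnected_connectedComponentIn.subset_connectedComponentIn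
      (mem_connectedComponentIn hx) ?_
    intro z hz hzKA
    have hzK := connectedComponentIn_subset _ _ hz
    rcases hzKA with h | h
    · exact hzK h
    · have := eq_of_mem_complComponents hF₀c (component_mem_complComponents hx) (hAsub z h hzK) hz
      exact hxF (this ▸ mem_connectedComponentIn hx)
  ext F
  constructor
  · rintro ⟨x, hx, rfl⟩
    simp only [compl_union, mem_inter_iff, mem_compl_iff] at hx
    by_cases hxF : x ∈ F₀
    · exact Or.inr ⟨x, ⟨hxF, hx.2⟩, rfl⟩
    · left
      rw [hother x hx.1 hxF]
      refine ⟨component_mem_complComponents hx.1, fun h => hxF ?_⟩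
      rw [mem_singleton_iff] at h
      rw [← h]
      exact mem_connectedComponentIn hx.1
  · rintro (⟨⟨x, hx, rfl⟩, hne⟩ | ⟨x, ⟨hxF, hxA⟩, rfl⟩)
    · have hxF : x ∉ F₀ := fun h => hne
        (eq_of_mem_complComponents (component_mem_complComponents hx) hF₀c
          (mem_connectedComponentIn hx) h)
      rw [← hother x hx hxF]
      refine component_mem_complComponents ?_
      rintro (h | h)
      · exact hx h
      · exact hxF (hAsub x h hx)
    · refine component_mem_complComponents ?_
      rintro (h | h)
      · exact hF₀K hxF h
      · exact hxA h

theorem arc_subset_closure (hc : Continuous γ) {F : Set ℂ} (h : γ '' Ioo 0 1 ⊆ closure F) :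
    γ '' Icc 0 1 ⊆ closure F := by
  have : γ '' Icc 0 1 ⊆ closure (γ '' Ioo 0 1) := by
    rw [← closure_Ioo (zero_ne_one (α := ℝ))]
    exact image_closure_subset_closure_image hc
  exact this.trans (closure_minimal h isClosed_closure)

/-- A chord between two parts of the boundary that do not meet does not separate a face. -/
theorem linked_union_arc_of_disjoint {K₁ K₂ : Set ℂ} (hK₁ : IsCompact K₁) (hK₂ : IsCompact K₂)
    (hdisj : Disjoint K₁ K₂) (hc : Continuous γ) (hγ : InjOn γ (Icc 0 1))
    (h₁ : K₁ ∩ γ '' Icc 0 1 = {γ 0}) (h₂ : K₂ ∩ γ '' Icc 0 1 = {γ 1}) {x y : ℂ}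
    (hxy : Linked (K₁ ∪ K₂)ᶜ x y) (hx : x ∉ γ '' Icc 0 1) (hy : y ∉ γ '' Icc 0 1) :
    Linked (K₁ ∪ K₂ ∪ γ '' Icc 0 1)ᶜ x y := by
  have hA : IsCompact (γ '' Icc 0 1) := isCompact_Icc.image hc
  have l1 := linked_compl_union hK₁ hA h₁ (hxy.mono (compl_subset_compl.2 subset_union_left))
    (linked_compl_arc hc zero_le_one hγ hx hy)
  have l2 := linked_compl_union (hK₁.union hA) hK₂ (p := γ 1) (by
    rw [union_inter_distrib_right, hdisj.inter_eq, empty_union, inter_comm, h₂]) l1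
    (hxy.mono (compl_subset_compl.2 subset_union_right))
  rwa [union_right_comm]

/-- The effect of a chord on the set of faces, when the chord does not separate. -/
theorem complComponents_union_arc_of_linked (hK : IsCompact K) (hc : Continuous γ)
    (hγ : InjOn γ (Icc 0 1)) (hKγ : K ∩ γ '' Icc 0 1 = {γ 0, γ 1})
    (hl : ∀ x y, Linked Kᶜ x y → x ∉ γ '' Icc 0 1 → y ∉ γ '' Icc 0 1 →
      Linked (K ∪ γ '' Icc 0 1)ᶜ x y) :
    ∃ F₀ ∈ complComponents K, ∃ F₁, complComponents (K ∪ γ '' Icc 0 1) =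
      complComponents K \ {F₀} ∪ {F₁} ∧ F₁ ⊆ F₀ ∧ γ '' Ioo 0 1 ⊆ F₀ ∧
      γ '' Icc 0 1 ⊆ closure F₁ := by
  have hIoo := image_Ioo_subset_component hc hγ hKγ
  have hunion := complComponents_union_arc hc hγ hKγ
  set A := γ '' Icc 0 1 with hA
  set F₀ := connectedComponentIn Kᶜ (γ (1 / 2)) with hF₀
  have hhalf : γ (1 / 2) ∈ F₀ := hIoo ⟨1 / 2, by norm_num, rfl⟩
  have hF₀K : F₀ ⊆ Kᶜ := connectedComponentIn_subset _ _
  have hF₀o : IsOpen F₀ := hK.isClosed.isOpen_compl.connectedComponentIn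
  have hlF : ∀ x ∈ F₀, ∀ y ∈ F₀, Linked Kᶜ x y := fun x hx y hy =>
    isPreconnected_connectedComponentIn.linked hF₀K hx hy
  obtain ⟨x, hxF, hxA⟩ : (F₀ \ A).Nonempty := by
    rw [sdiff_nonempty]
    exact not_subset_arc hc hγ hF₀o ⟨_, hhalf⟩
  have hall : F₀ \ A ⊆ connectedComponentIn (K ∪ A)ᶜ x := fun y hy =>
    (hl x y (hlF x hxF y hy.1) hxA hy.2).mem_component
  refine ⟨F₀, component_mem_complComponents (hF₀K hhalf), connectedComponentIn (K ∪ A)ᶜ x, ?_, ?_,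
    hIoo, ?_⟩
  · rw [hunion]
    congr 1
    apply Subset.antisymm
    · rintro _ ⟨y, hy, rfl⟩
      exact (connectedComponentIn_eq (hall hy)).symm
    · rintro _ rfl
      exact ⟨x, ⟨hxF, hxA⟩, rfl⟩
  · rw [hF₀, connectedComponentIn_eq hxF]
    exact connectedComponentIn_mono x (compl_subset_compl.2 subset_union_left)
  · refine arc_subset_closure hc ?_
    intro z hz
    rw [mem_closure_iff]
    intro O hO hzO
    -- As the arc has empty interior, every neighbourhood of one of its inner points contains points
    -- of F₀ off the arc, all of which lie in the one new component.
    have : ¬ O ∩ F₀ ⊆ A := not_subset_arc hc hγ (hO.inter hF₀o) ⟨z, hzO, hIoo hz⟩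
    obtain ⟨w, hw, hwA⟩ := not_subset.1 this
    exact ⟨w, hw.1, hall ⟨hw.2, hwA⟩⟩

/-- The effect of a chord on the set of faces, when its ends are joined in the boundary. -/
theorem complComponents_union_arc_of_path (hK : IsCompact K) (hc : Continuous γ)
    (hγ : InjOn γ (Icc 0 1)) (hKγ : K ∩ γ '' Icc 0 1 = {γ 0, γ 1})
    (hj : JoinedIn K (γ 0) (γ 1)) :
    ∃ F₀ ∈ complComponents K, ∃ F₁ F₂, F₁ ≠ F₂ ∧ complComponents (K ∪ γ '' Icc 0 1) =
      complComponents K \ {F₀} ∪ {F₁, F₂} ∧ F₁ ⊆ F₀ ∧ F₂ ⊆ F₀ ∧ γ '' Ioo 0 1 ⊆ F₀ ∧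
      γ '' Icc 0 1 ⊆ closure F₁ ∧ γ '' Icc 0 1 ⊆ closure F₂ := by
  have hIoo := image_Ioo_subset_component hc hγ hKγ
  have hunion := complComponents_union_arc hc hγ hKγ
  obtain ⟨x, ⟨hxF, hxA⟩, y, ⟨hyF, hyA⟩, hn⟩ := exists_not_linked_of_path hK.isClosed hc hγ
    hj.somePath.toContinuousMap (fun t => hj.somePath_mem t) hj.somePath.source
    hj.somePath.target hIoo
  have hcl := fun (p q : ℂ) => mem_closure_of_not_linked hK hc hγ hKγ (x := p) (y := q)
  have hAc : IsCompact (γ '' Icc 0 1) := isCompact_Icc.image hc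
  have hab : γ 0 ≠ γ 1 := fun h => by
    have := hγ (by simp) (by simp) h
    norm_num at this
  have htwo := fun z => linked_of_inter_eq_pair hK hAc hab hKγ (x := x) (y := y) (z := z)
  have harc : ∀ z ∉ γ '' Icc 0 1, ∀ w ∉ γ '' Icc 0 1, Linked (γ '' Icc 0 1)ᶜ z w :=
    fun z hz w hw => linked_compl_arc hc zero_le_one hγ hz hw
  set A := γ '' Icc 0 1 with hA
  set F₀ := connectedComponentIn Kᶜ (γ (1 / 2)) with hF₀
  have hhalf : γ (1 / 2) ∈ F₀ := hIoo ⟨1 / 2, by norm_num, rfl⟩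
  have hF₀K : F₀ ⊆ Kᶜ := connectedComponentIn_subset _ _
  have hlF : ∀ x ∈ F₀, ∀ y ∈ F₀, Linked Kᶜ x y := fun x hx y hy =>
    isPreconnected_connectedComponentIn.linked hF₀K hx hy
  have hU : ∀ z ∈ F₀, z ∉ A → z ∈ (K ∪ A)ᶜ := by
    intro z hz hzA
    have := hF₀K hz
    simp_all
  have hsub : ∀ z ∈ F₀, connectedComponentIn (K ∪ A)ᶜ z ⊆ F₀ := by
    intro z hz
    rw [hF₀, connectedComponentIn_eq hz]
    exact connectedComponentIn_mono z (compl_subset_compl.2 subset_union_left)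
  refine ⟨F₀, component_mem_complComponents (hF₀K hhalf), connectedComponentIn (K ∪ A)ᶜ x,
    connectedComponentIn (K ∪ A)ᶜ y, ?_, ?_, hsub x hxF, hsub y hyF, hIoo, ?_, ?_⟩
  · intro h
    exact hn (Linked.iff_mem_component.2 ⟨hU x hxF hxA, h ▸ mem_connectedComponentIn (hU y hyF hyA)⟩)
  · rw [hunion]
    congr 1
    apply Subset.antisymm
    · rintro _ ⟨z, ⟨hzF, hzA⟩, rfl⟩
      -- K and the arc meet exactly in the two ends, so at most two new components arise.
      rcases htwo z (hlF x hxF y hyF) (harc x hxA y hyA) (hlF x hxF z hzF) (harc x hxA z hzA)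
        with h | h | h
      · exact absurd h hn
      · exact Or.inl (connectedComponentIn_eq h.mem_component).symm
      · exact Or.inr (connectedComponentIn_eq h.mem_component).symm
    · rintro _ (rfl | rfl)
      · exact ⟨x, ⟨hxF, hxA⟩, rfl⟩
      · exact ⟨y, ⟨hyF, hyA⟩, rfl⟩
  · refine arc_subset_closure hc ?_
    rintro _ ⟨r, hr, rfl⟩
    exact hcl _ _ (hlF x hxF y hyF) hxA hyA hn hr
  · refine arc_subset_closure hc ?_
    rintro _ ⟨r, hr, rfl⟩
    exact hcl _ _ (hlF y hyF x hxF) hyA hxA (fun h => hn h.symm) hr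

end Arc

/-! ### Drawings and the deletion of an edge -/

theorem IsPlaneArc.exists_param {p q : ℂ} {A : Set ℂ} (h : IsPlaneArc p q A) :
    ∃ γ : ℝ → ℂ, Continuous γ ∧ InjOn γ (Icc 0 1) ∧ γ 0 = p ∧ γ 1 = q ∧ γ '' Icc 0 1 = A := by
  obtain ⟨γ, hc, hi, h0, h1, hr⟩ := h
  refine ⟨IccExtend zero_le_one γ, hc.Icc_extend', ?_, ?_, ?_, ?_⟩
  · intro s hs t ht hst
    rw [IccExtend_of_mem _ _ hs, IccExtend_of_mem _ _ ht] at hst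
    exact congrArg Subtype.val (hi hst)
  · rw [IccExtend_left]
    exact h0
  · rw [IccExtend_right]
    exact h1
  · rw [← hr]
    ext z
    constructor
    · rintro ⟨t, ht, rfl⟩
      rw [IccExtend_of_mem _ _ ht]
      exact ⟨_, rfl⟩
    · rintro ⟨t, rfl⟩
      exact ⟨t, t.2, by rw [IccExtend_of_mem _ _ t.2]⟩

namespace PlaneEmbedding

variable {V : Type*} {G H : SimpleGraph V} (D : PlaneEmbedding G)

/-- The drawing of a spanning subgraph. -/
def mono (h : H ≤ G) : PlaneEmbedding H where
  point := D.point
  arc := D.arc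
  point_injective := D.point_injective
  isPlaneArc u v huv := D.isPlaneArc u v (h huv)
  mem_of_point_mem_arc e he := D.mem_of_point_mem_arc e (SimpleGraph.edgeSet_mono h he)
  arc_inter_arc e he e' he' := D.arc_inter_arc e (SimpleGraph.edgeSet_mono h he) e'
    (SimpleGraph.edgeSet_mono h he')

@[simp] theorem mono_point (h : H ≤ G) : (D.mono h).point = D.point := rfl

@[simp] theorem mono_arc (h : H ≤ G) : (D.mono h).arc = D.arc := rfl

/-- The part of the drawing on a set of vertices. -/
def supportOn (S : Set V) : Set ℂ :=
  D.point '' S ∪ ⋃ e ∈ {e | e ∈ G.edgeSet ∧ ∀ w ∈ e, w ∈ S}, D.arc e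

theorem supportOn_univ : D.supportOn univ = D.support := by
  simp [supportOn, support]

theorem isCompact_arc {e : Sym2 V} (he : e ∈ G.edgeSet) : IsCompact (D.arc e) := by
  induction e with | h u v
  obtain ⟨γ, hc, -, -, -, hγ⟩ := (D.isPlaneArc u v he).exists_param
  rw [← hγ]
  exact isCompact_Icc.image hc

theorem point_mem_arc {e : Sym2 V} (he : e ∈ G.edgeSet) {w : V} (hw : w ∈ e) :
    D.point w ∈ D.arc e := by
  induction e with | h u v
  obtain ⟨γ, hc, -, h0, h1, hγ⟩ := (D.isPlaneArc u v he).exists_param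
  rw [← hγ]
  rcases Sym2.mem_iff.1 hw with rfl | rfl
  · exact ⟨0, by simp, h0⟩
  · exact ⟨1, by simp, h1⟩

theorem isCompact_supportOn [Finite V] (S : Set V) : IsCompact (D.supportOn S) := by
  refine (S.toFinite.image _).isCompact.union ?_
  exact Set.Finite.isCompact_biUnion (toFinite _) (fun e he => D.isCompact_arc he.1)

theorem isCompact_support [Finite V] : IsCompact D.support := by
  rw [← supportOn_univ]
  exact D.isCompact_supportOn _

theorem exists_mem_of_mem_supportOn_of_mem_arc (h : H ≤ G) {S : Set V} {z : ℂ}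
    (hz : z ∈ (D.mono h).supportOn S) {e : Sym2 V} (he : e ∈ G.edgeSet) (heH : e ∉ H.edgeSet)
    (hze : z ∈ D.arc e) : ∃ w ∈ S, w ∈ e ∧ z = D.point w := by
  rcases hz with ⟨w, hw, rfl⟩ | hz
  · exact ⟨w, hw, D.mem_of_point_mem_arc e he w hze, rfl⟩
  · simp only [mem_iUnion] at hz
    obtain ⟨e', ⟨he', hS⟩, hz⟩ := hz
    have hne : e' ≠ e := fun h => heH (h ▸ he')
    obtain ⟨w, ⟨hw, hw'⟩, rfl⟩ :=
      D.arc_inter_arc e' (SimpleGraph.edgeSet_mono h he') e he hne ⟨hz, hze⟩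
    exact ⟨w, hS w hw, hw', rfl⟩

theorem disjoint_supportOn {S T : Set V} (hST : Disjoint S T) :
    Disjoint (D.supportOn S) (D.supportOn T) := by
  rw [Set.disjoint_left] at *
  rintro z hz hz'
  have hp : ∀ {S T : Set V}, (∀ ⦃w⦄, w ∈ S → w ∉ T) → ∀ w ∈ S, D.point w ∉ D.supportOn T := by
    rintro S T hST w hw (⟨w', hw', h⟩ | h)
    · exact hST hw (D.point_injective h ▸ hw')
    · simp only [mem_iUnion] at h
      obtain ⟨e, ⟨he, hT⟩, h⟩ := h
      exact hST hw (hT w (D.mem_of_point_mem_arc e he w h))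
  rcases hz with ⟨w, hw, rfl⟩ | hz
  · exact hp hST w hw hz'
  rcases hz' with ⟨w, hw, rfl⟩ | hz'
  · exact hp (fun w h h' => hST h' h) w hw (Or.inr hz)
  · simp only [mem_iUnion] at hz hz'
    obtain ⟨e, ⟨he, hS⟩, hz⟩ := hz
    obtain ⟨e', ⟨he', hT⟩, hz'⟩ := hz'
    have hne : e ≠ e' := by
      rintro rfl
      induction e with | h u v
      exact hST (hS u (by simp)) (hT u (by simp))
    obtain ⟨w, ⟨hw, hw'⟩, -⟩ := D.arc_inter_arc e he e' he' hne ⟨hz, hz'⟩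
    exact hST (hS w hw) (hT w hw')

theorem support_eq_supportOn_union {S : Set V} (hS : ∀ u v, G.Adj u v → u ∈ S → v ∈ S) :
    D.support = D.supportOn S ∪ D.supportOn Sᶜ := by
  apply Subset.antisymm
  · rintro z (⟨w, rfl⟩ | hz)
    · by_cases hw : w ∈ S
      · exact Or.inl (Or.inl ⟨w, hw, rfl⟩)
      · exact Or.inr (Or.inl ⟨w, hw, rfl⟩)
    · simp only [mem_iUnion] at hz
      obtain ⟨e, he, hz⟩ := hz
      induction e with | h u v
      by_cases hu : u ∈ S
      · refine Or.inl (Or.inr ?_)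
        simp only [mem_iUnion]
        refine ⟨s(u, v), ⟨he, ?_⟩, hz⟩
        simp [hu, hS u v he hu]
      · refine Or.inr (Or.inr ?_)
        simp only [mem_iUnion]
        refine ⟨s(u, v), ⟨he, ?_⟩, hz⟩
        have : v ∉ S := fun hv => hu (hS v u (SimpleGraph.Adj.symm he) hv)
        simp [hu, this]
  · rw [← supportOn_univ]
    have hm : ∀ T : Set V, D.supportOn T ⊆ D.supportOn univ := by
      rintro T z (⟨w, -, rfl⟩ | hz)
      · exact Or.inl ⟨w, mem_univ _, rfl⟩
      · refine Or.inr ?_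
        simp only [mem_iUnion] at hz ⊢
        obtain ⟨e, he, hz⟩ := hz
        exact ⟨e, ⟨he.1, fun _ _ => mem_univ _⟩, hz⟩
    exact union_subset (hm _) (hm _)

theorem joinedIn_support_of_reachable {u v : V} (h : G.Reachable u v) :
    JoinedIn D.support (D.point u) (D.point v) := by
  obtain ⟨p⟩ := h
  induction p with
  | nil => exact JoinedIn.refl (Or.inl ⟨_, rfl⟩)
  | @cons u v w huv p ih =>
    refine JoinedIn.trans ?_ ih
    obtain ⟨γ, hc, -, h0, h1, hγ⟩ := (D.isPlaneArc u v huv).exists_param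
    refine (JoinedIn.ofLine hc.continuousOn h0 h1 ?_)
    change γ '' Icc 0 1 ⊆ _
    rw [hγ]
    refine subset_trans ?_ subset_union_right
    exact subset_biUnion_of_mem (u := D.arc) (show s(u, v) ∈ G.edgeSet from huv)

/-- The drawing without one edge. -/
abbrev delete (e : Sym2 V) : PlaneEmbedding (G.deleteEdges {e}) :=
  D.mono (G.deleteEdges_le {e})

theorem support_eq_delete_union {e : Sym2 V} (he : e ∈ G.edgeSet) :
    D.support = (D.delete e).support ∪ D.arc e := by
  have : G.edgeSet = insert e (G.deleteEdges {e}).edgeSet := by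
    rw [SimpleGraph.edgeSet_deleteEdges, insert_sdiff_singleton, insert_eq_of_mem he]
  rw [support, this, biUnion_insert, support, mono_point, mono_arc]
  rw [union_comm (D.arc e), union_assoc]

/-- The points of an edge other than its ends. -/
def openArc (e : Sym2 V) : Set ℂ := D.arc e \ range D.point

theorem exists_param {u v : V} (h : G.Adj u v) :
    ∃ γ : ℝ → ℂ, Continuous γ ∧ InjOn γ (Icc 0 1) ∧ γ 0 = D.point u ∧ γ 1 = D.point v ∧
      γ '' Icc 0 1 = D.arc s(u, v) ∧ γ '' Ioo 0 1 = D.openArc s(u, v) := by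
  obtain ⟨γ, hc, hi, h0, h1, hγ⟩ := (D.isPlaneArc u v h).exists_param
  refine ⟨γ, hc, hi, h0, h1, hγ, ?_⟩
  rw [openArc, ← hγ]
  ext z
  constructor
  · rintro ⟨t, ht, rfl⟩
    refine ⟨⟨t, Ioo_subset_Icc_self ht, rfl⟩, ?_⟩
    rintro ⟨w, hw⟩
    have hwA : D.point w ∈ D.arc s(u, v) := by
      rw [hw, ← hγ]
      exact ⟨t, Ioo_subset_Icc_self ht, rfl⟩
    rcases Sym2.mem_iff.1 (D.mem_of_point_mem_arc _ h w hwA) with rfl | rfl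
    · rw [← h0] at hw
      exact ht.1.ne (hi (by simp) (Ioo_subset_Icc_self ht) hw)
    · rw [← h1] at hw
      exact ht.2.ne' (hi (by simp) (Ioo_subset_Icc_self ht) hw)
  · rintro ⟨⟨t, ht, rfl⟩, hz⟩
    refine ⟨t, ⟨lt_of_le_of_ne ht.1 ?_, lt_of_le_of_ne ht.2 ?_⟩, rfl⟩
    · rintro rfl
      exact hz ⟨u, h0.symm⟩
    · rintro rfl
      exact hz ⟨v, h1.symm⟩

theorem delete_support_inter_arc {u v : V} (h : G.Adj u v) :
    (D.delete s(u, v)).support ∩ D.arc s(u, v) = {D.point u, D.point v} := by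
  apply Subset.antisymm
  · rintro z ⟨hz, hz'⟩
    rw [← supportOn_univ] at hz
    obtain ⟨w, -, hw, rfl⟩ := D.exists_mem_of_mem_supportOn_of_mem_arc _ hz h (by simp) hz'
    rcases Sym2.mem_iff.1 hw with rfl | rfl <;> simp
  · rintro z (rfl | rfl)
    · exact ⟨Or.inl ⟨u, rfl⟩, D.point_mem_arc h (by simp)⟩
    · exact ⟨Or.inl ⟨v, rfl⟩, D.point_mem_arc h (by simp)⟩

theorem faces_eq : D.faces = complComponents D.support := rfl

/-- Without the bridge the drawing falls into two disjoint compact parts, each meeting the arc in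
one end. Such an arc separates nothing. -/
theorem faces_of_isBridge [Finite V] {e : Sym2 V} (he : e ∈ G.edgeSet) (hb : G.IsBridge e) :
    ∃ F₀ ∈ (D.delete e).faces, ∃ F₁, D.faces = (D.delete e).faces \ {F₀} ∪ {F₁} ∧ F₁ ⊆ F₀ ∧
      D.openArc e ⊆ F₀ ∧ D.arc e ⊆ closure F₁ := by
  induction e with | h u v
  obtain ⟨γ, hc, hi, h0, h1, hγ, hγ'⟩ := D.exists_param he
  have hint := D.delete_support_inter_arc he
  rw [faces_eq, faces_eq, D.support_eq_delete_union he]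
  rw [← hγ, ← h0, ← h1] at hint
  rw [← hγ, ← hγ']
  refine complComponents_union_arc_of_linked (isCompact_support _) hc hi hint ?_
  intro x y hxy hx hy
  have hS : ∀ w w', (G.deleteEdges {s(u, v)}).Adj w w' →
      w ∈ {w | (G.deleteEdges {s(u, v)}).Reachable u w} →
      w' ∈ {w | (G.deleteEdges {s(u, v)}).Reachable u w} :=
    fun w w' h hw => SimpleGraph.Reachable.trans hw h.reachable
  have hvS : v ∉ {w | (G.deleteEdges {s(u, v)}).Reachable u w} := SimpleGraph.isBridge_iff.1 hb
  rw [(D.delete s(u, v)).support_eq_supportOn_union hS] at hxy ⊢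
  refine linked_union_arc_of_disjoint (isCompact_supportOn _ _) (isCompact_supportOn _ _)
    (disjoint_supportOn _ disjoint_compl_right) hc hi ?_ ?_ hxy hx hy
  · rw [hγ, h0]
    apply Subset.antisymm
    · rintro z ⟨hz, hz'⟩
      obtain ⟨w, hwS, hw, rfl⟩ := D.exists_mem_of_mem_supportOn_of_mem_arc _ hz he (by simp) hz'
      rcases Sym2.mem_iff.1 hw with rfl | rfl
      · rfl
      · exact absurd hwS hvS
    · rintro z rfl
      exact ⟨Or.inl ⟨u, SimpleGraph.Reachable.refl _, rfl⟩, D.point_mem_arc he (by simp)⟩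
  · rw [hγ, h1]
    apply Subset.antisymm
    · rintro z ⟨hz, hz'⟩
      obtain ⟨w, hwS, hw, rfl⟩ := D.exists_mem_of_mem_supportOn_of_mem_arc _ hz he (by simp) hz'
      rcases Sym2.mem_iff.1 hw with rfl | rfl
      · exact absurd (SimpleGraph.Reachable.refl _) hwS
      · rfl
    · rintro z rfl
      exact ⟨Or.inl ⟨v, hvS, rfl⟩, D.point_mem_arc he (by simp)⟩

/-- The ends remain connected in the graph without the edge, hence are joined by a path in its
drawing; the crosscut then splits one face in two. -/
theorem faces_of_not_isBridge [Finite V] {e : Sym2 V} (he : e ∈ G.edgeSet)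
    (hb : ¬ G.IsBridge e) :
    ∃ F₀ ∈ (D.delete e).faces, ∃ F₁ F₂, F₁ ≠ F₂ ∧
      D.faces = (D.delete e).faces \ {F₀} ∪ {F₁, F₂} ∧ F₁ ⊆ F₀ ∧ F₂ ⊆ F₀ ∧
      D.openArc e ⊆ F₀ ∧ D.arc e ⊆ closure F₁ ∧ D.arc e ⊆ closure F₂ := by
  induction e with | h u v
  obtain ⟨γ, hc, hi, h0, h1, hγ, hγ'⟩ := D.exists_param he
  have hint := D.delete_support_inter_arc he
  rw [SimpleGraph.isBridge_iff, not_not] at hb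
  have hj := (D.delete s(u, v)).joinedIn_support_of_reachable hb
  rw [mono_point, ← h0, ← h1] at hj
  rw [faces_eq, faces_eq, D.support_eq_delete_union he]
  rw [← hγ, ← h0, ← h1] at hint
  rw [← hγ, ← hγ']
  exact complComponents_union_arc_of_path (isCompact_support _) hc hi hint hj

end PlaneEmbedding

/-! ### Edge-face incidence and Euler's formula -/

namespace PlaneEmbedding

variable {V : Type*} {G H : SimpleGraph V} (D : PlaneEmbedding G)

theorem openArc_nonempty {e : Sym2 V} (he : e ∈ G.edgeSet) : (D.openArc e).Nonempty := by
  induction e with | h u v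
  obtain ⟨γ, -, -, -, -, -, hγ⟩ := D.exists_param he
  rw [← hγ]
  exact ⟨γ (1 / 2), 1 / 2, by norm_num, rfl⟩

theorem arc_subset_support {e : Sym2 V} (he : e ∈ G.edgeSet) : D.arc e ⊆ D.support :=
  (subset_biUnion_of_mem (u := D.arc) he).trans subset_union_right

/-- The faces with a given edge on their boundary. -/
def incidentFaces (e : Sym2 V) : Set (Set ℂ) := {F | F ∈ D.faces ∧ e ∈ D.boundaryEdges F}

theorem exists_openArc_of_mem_support {z : ℂ} (hz : z ∈ D.support) (hz' : z ∉ range D.point) :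
    ∃ e ∈ G.edgeSet, z ∈ D.openArc e := by
  rcases hz with h | h
  · exact absurd h hz'
  · simp only [mem_iUnion] at h
    obtain ⟨e, he, h⟩ := h
    exact ⟨e, he, h, hz'⟩

/-- The graph formed by the boundary edges of a face. -/
def boundaryGraph (F : Set ℂ) : SimpleGraph V := SimpleGraph.fromEdgeSet (D.boundaryEdges F)

theorem edgeSet_boundaryGraph (F : Set ℂ) : (D.boundaryGraph F).edgeSet = D.boundaryEdges F := by
  rw [boundaryGraph, SimpleGraph.edgeSet_fromEdgeSet, sdiff_eq_left, Set.disjoint_left]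
  intro e he hd
  exact G.not_isDiag_of_mem_edgeSet he.1 hd

theorem boundaryGraph_le (F : Set ℂ) : D.boundaryGraph F ≤ G := by
  rw [← SimpleGraph.edgeSet_subset_edgeSet, edgeSet_boundaryGraph]
  exact fun e he => he.1

theorem support_mono_subset (h : H ≤ G) : (D.mono h).support ⊆ D.support := by
  refine union_subset_union_right _ ?_
  exact biUnion_subset_biUnion_left (SimpleGraph.edgeSet_mono h)

section Finite

variable [Finite V]

theorem isOpen_face {F : Set ℂ} (hF : F ∈ D.faces) : IsOpen F :=
  isOpen_of_mem_complComponents D.isCompact_support.isClosed hF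

theorem mem_boundaryEdges_of_subset_closure {F : Set ℂ} (hF : F ∈ D.faces) {e : Sym2 V}
    (he : e ∈ G.edgeSet) (h : D.arc e ⊆ closure F) : e ∈ D.boundaryEdges F := by
  refine ⟨he, fun z hz => ?_⟩
  rw [(D.isOpen_face hF).frontier_eq]
  exact ⟨h hz, fun hzF => subset_compl_of_mem_complComponents hF hzF (D.arc_subset_support he hz)⟩

/-- An old face other than F₀ is disjoint from the open set F₀, so its closure misses the open arc.
Only the new faces can touch the edge away from its ends. -/
theorem incidentFaces_of_faces_eq {e : Sym2 V} (he : e ∈ G.edgeSet) {F₀ : Set ℂ}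
    (hF₀ : F₀ ∈ (D.delete e).faces) {S : Set (Set ℂ)}
    (hS : D.faces = (D.delete e).faces \ {F₀} ∪ S) (ho : D.openArc e ⊆ F₀)
    (hc : ∀ F ∈ S, D.arc e ⊆ closure F) :
    D.incidentFaces e = S ∧ Disjoint ((D.delete e).faces \ {F₀}) S ∧
      ∀ F ∈ D.faces, ∀ z ∈ D.openArc e, z ∈ closure F → e ∈ D.boundaryEdges F := by
  have hSf : ∀ F ∈ S, F ∈ D.faces := fun F hF => hS ▸ Or.inr hF
  have hother : ∀ F ∈ (D.delete e).faces \ {F₀}, ∀ z ∈ D.openArc e, z ∉ closure F := by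
    rintro F ⟨hF, hne⟩ z hz hzF
    have hd : Disjoint F F₀ := by
      rw [Set.disjoint_left]
      intro w hw hw'
      exact hne (eq_of_mem_complComponents hF hF₀ hw hw')
    exact Set.disjoint_left.1 (hd.closure_left ((D.delete e).isOpen_face hF₀)) hzF (ho hz)
  obtain ⟨z₀, hz₀⟩ := D.openArc_nonempty he
  refine ⟨?_, ?_, ?_⟩
  · apply Subset.antisymm
    · rintro F ⟨hF, hFe⟩
      have hF' := hF
      rw [hS] at hF'
      rcases hF' with h | h
      · exact absurd (frontier_subset_closure (hFe.2 hz₀.1)) (hother F h z₀ hz₀)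
      · exact h
    · intro F hF
      exact ⟨hSf F hF, D.mem_boundaryEdges_of_subset_closure (hSf F hF) he (hc F hF)⟩
  · rw [Set.disjoint_left]
    intro F hF hFS
    exact hother F hF z₀ hz₀ (hc F hFS hz₀.1)
  · intro F hF z hz hzF
    have hF' := hF
    rw [hS] at hF'
    rcases hF' with h | h
    · exact absurd hzF (hother F h z hz)
    · exact D.mem_boundaryEdges_of_subset_closure hF he (hc F h)

theorem incidentFaces_of_isBridge {e : Sym2 V} (he : e ∈ G.edgeSet) (hb : G.IsBridge e) :
    ∃ F, D.incidentFaces e = {F} := by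
  obtain ⟨F₀, hF₀, F₁, hf, -, ho, hc⟩ := D.faces_of_isBridge he hb
  exact ⟨F₁, (D.incidentFaces_of_faces_eq he hF₀ hf ho (by simpa using hc)).1⟩

theorem incidentFaces_of_not_isBridge {e : Sym2 V} (he : e ∈ G.edgeSet) (hb : ¬ G.IsBridge e) :
    ∃ F F', F ≠ F' ∧ D.incidentFaces e = {F, F'} := by
  obtain ⟨F₀, hF₀, F₁, F₂, hne, hf, -, -, ho, hc, hc'⟩ := D.faces_of_not_isBridge he hb
  exact ⟨F₁, F₂, hne, (D.incidentFaces_of_faces_eq he hF₀ hf ho (by simp [hc, hc'])).1⟩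

/-- Incidence is all or nothing: a single inner point of the edge in the closure of a face puts the
whole arc on its boundary. -/
theorem mem_boundaryEdges_of_mem_closure {e : Sym2 V} (he : e ∈ G.edgeSet) {F : Set ℂ}
    (hF : F ∈ D.faces) {z : ℂ} (hz : z ∈ D.openArc e) (hzF : z ∈ closure F) :
    e ∈ D.boundaryEdges F := by
  by_cases hb : G.IsBridge e
  · obtain ⟨F₀, hF₀, F₁, hf, -, ho, hc⟩ := D.faces_of_isBridge he hb
    exact (D.incidentFaces_of_faces_eq he hF₀ hf ho (by simpa using hc)).2.2 F hF z hz hzF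
  · obtain ⟨F₀, hF₀, F₁, F₂, hne, hf, -, -, ho, hc, hc'⟩ := D.faces_of_not_isBridge he hb
    exact (D.incidentFaces_of_faces_eq he hF₀ hf ho (by simp [hc, hc'])).2.2 F hF z hz hzF

theorem ncard_edgeSet_delete {e : Sym2 V} (he : e ∈ G.edgeSet) :
    (G.deleteEdges {e}).edgeSet.ncard + 1 = G.edgeSet.ncard := by
  rw [SimpleGraph.edgeSet_deleteEdges]
  exact ncard_sdiff_singleton_add_one he (toFinite _)

theorem faces_of_edgeSet_eq_empty (h : G.edgeSet = ∅) : D.faces.ncard = 1 := by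
  have hs : D.support = range D.point := by simp [support, h]
  have hc : IsConnected (range D.point)ᶜ :=
    (finite_range D.point).countable.isConnected_compl_of_one_lt_rank
      (by rw [Complex.rank_real_complex]; norm_num)
  rw [ncard_eq_one]
  refine ⟨(range D.point)ᶜ, ?_⟩
  ext F
  rw [faces_eq, hs, mem_singleton_iff]
  constructor
  · rintro ⟨x, hx, rfl⟩
    exact hc.isPreconnected.connectedComponentIn hx
  · rintro rfl
    obtain ⟨x, hx⟩ := hc.nonempty
    exact ⟨x, hx, (hc.isPreconnected.connectedComponentIn hx).symm⟩

theorem finite_faces : D.faces.Finite := by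
  induction hn : G.edgeSet.ncard generalizing G with
  | zero =>
    rw [ncard_eq_zero (toFinite _)] at hn
    exact finite_of_ncard_ne_zero (by rw [D.faces_of_edgeSet_eq_empty hn]; exact one_ne_zero)
  | succ n ih =>
    obtain ⟨e, he⟩ : G.edgeSet.Nonempty := nonempty_of_ncard_ne_zero (by omega)
    have hD := ih (D.delete e) (by have := ncard_edgeSet_delete he; omega)
    by_cases hb : G.IsBridge e
    · obtain ⟨F₀, hF₀, F₁, hf, -⟩ := D.faces_of_isBridge he hb
      rw [hf]
      exact hD.sdiff.union (finite_singleton _)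
    · obtain ⟨F₀, hF₀, F₁, F₂, hne, hf, -⟩ := D.faces_of_not_isBridge he hb
      rw [hf]
      exact hD.sdiff.union (toFinite _)

theorem ncard_faces_of_isBridge {e : Sym2 V} (he : e ∈ G.edgeSet) (hb : G.IsBridge e) :
    D.faces.ncard = (D.delete e).faces.ncard := by
  obtain ⟨F₀, hF₀, F₁, hf, -, ho, hc⟩ := D.faces_of_isBridge he hb
  have hd := (D.incidentFaces_of_faces_eq he hF₀ hf ho (by simpa using hc)).2.1
  rw [hf, ncard_union_eq hd (D.delete e).finite_faces.sdiff (toFinite _), ncard_singleton]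
  exact ncard_sdiff_singleton_add_one hF₀ (D.delete e).finite_faces

theorem ncard_faces_of_not_isBridge {e : Sym2 V} (he : e ∈ G.edgeSet) (hb : ¬ G.IsBridge e) :
    D.faces.ncard = (D.delete e).faces.ncard + 1 := by
  obtain ⟨F₀, hF₀, F₁, F₂, hne, hf, -, -, ho, hc, hc'⟩ := D.faces_of_not_isBridge he hb
  have hd := (D.incidentFaces_of_faces_eq he hF₀ hf ho (by simp [hc, hc'])).2.1
  rw [hf, ncard_union_eq hd (D.delete e).finite_faces.sdiff (toFinite _), ncard_pair hne]
  have := ncard_sdiff_singleton_add_one hF₀ (D.delete e).finite_faces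
  omega

/-- All edges of a forest are bridges, and deleting a bridge does not change the number of faces. -/
theorem ncard_faces_of_isAcyclic (h : G.IsAcyclic) : D.faces.ncard = 1 := by
  induction hn : G.edgeSet.ncard generalizing G with
  | zero =>
    rw [ncard_eq_zero (toFinite _)] at hn
    exact D.faces_of_edgeSet_eq_empty hn
  | succ n ih =>
    obtain ⟨e, he⟩ : G.edgeSet.Nonempty := nonempty_of_ncard_ne_zero (by omega)
    rw [D.ncard_faces_of_isBridge he (SimpleGraph.isAcyclic_iff_forall_isBridge.1 h he)]
    exact ih (D.delete e) (h.anti (G.deleteEdges_le {e}))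
      (by have := ncard_edgeSet_delete he; omega)

/-- Euler's formula. -/
theorem ncard_faces_add_card (h : G.Connected) :
    D.faces.ncard + Nat.card V = G.edgeSet.ncard + 2 := by
  induction hn : G.edgeSet.ncard using Nat.strong_induction_on generalizing G with
  | _ n ih =>
    by_cases ha : G.IsAcyclic
    · have ht := (SimpleGraph.isTree_iff_connected_and_card.1 ⟨h, ha⟩).2
      rw [Nat.card_coe_set_eq] at ht
      rw [D.ncard_faces_of_isAcyclic ha]
      omega
    · rw [SimpleGraph.isAcyclic_iff_forall_isBridge] at ha
      push Not at ha
      obtain ⟨e, he, hb⟩ := ha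
      have hcard := ncard_edgeSet_delete he
      have hcon : (G.deleteEdges {e}).Connected := by
        induction e with | h u v
        exact h.connected_delete_edge_of_not_isBridge hb
      have := ih _ (by omega) (D.delete e) hcon rfl
      rw [D.ncard_faces_of_not_isBridge he hb]
      omega

/-! ### Connectedness of the dual graph and cycles in face boundaries -/

theorem dense_compl_support : Dense D.supportᶜ := by
  have h1 : Dense (range D.point)ᶜ := (finite_range D.point).countable.dense_compl ℝ
  have h2 : Dense (⋂ e ∈ G.edgeSet, (D.arc e)ᶜ) := by
    refine dense_biInter_of_isOpen (fun e he => (D.isCompact_arc he).isClosed.isOpen_compl)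
      (toFinite _).countable ?_
    intro e he
    induction e with | h u v
    obtain ⟨γ, hc, hi, -, -, hγ, -⟩ := D.exists_param he
    rw [← interior_eq_empty_iff_dense_compl, ← not_nonempty_iff_eq_empty]
    intro hne
    exact not_subset_arc hc hi isOpen_interior hne (hγ ▸ interior_subset)
  have : D.supportᶜ = (range D.point)ᶜ ∩ ⋂ e ∈ G.edgeSet, (D.arc e)ᶜ := by
    simp [support, compl_iUnion]
  rw [this]
  exact h1.inter_of_isOpen_left h2 (finite_range D.point).isClosed.isOpen_compl

theorem exists_face_mem_closure (z : ℂ) : ∃ F ∈ D.faces, z ∈ closure F := by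
  have hz : z ∈ closure (⋃ F ∈ D.faces, F) := by
    refine closure_mono ?_ (D.dense_compl_support z)
    intro w hw
    simp only [mem_iUnion]
    exact ⟨_, component_mem_complComponents hw, mem_connectedComponentIn hw⟩
  rw [D.finite_faces.closure_biUnion] at hz
  simpa using hz

theorem eq_of_mem_closure_of_notMem_support {F : Set ℂ} (hF : F ∈ D.faces) {z : ℂ}
    (hz : z ∉ D.support) (hzF : z ∈ closure F) : z ∈ F := by
  obtain ⟨w, hw, hwF⟩ := mem_closure_iff.1 hzF _
    D.isCompact_support.isClosed.isOpen_compl.connectedComponentIn (mem_connectedComponentIn hz)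
  rw [eq_of_mem_complComponents hF (component_mem_complComponents hz) hwF hw]
  exact mem_connectedComponentIn hz

/-- The dual graph is connected: a nonempty family of faces that is closed under sharing an edge
contains all faces. -/
theorem eq_faces_of_forall_incident {𝓕 : Set (Set ℂ)} (hsub : 𝓕 ⊆ D.faces) (hne : 𝓕.Nonempty)
    (h : ∀ e, ∀ F ∈ 𝓕, ∀ F' ∈ D.faces, e ∈ D.boundaryEdges F → e ∈ D.boundaryEdges F' →
      F' ∈ 𝓕) : 𝓕 = D.faces := by
  refine Subset.antisymm hsub ?_
  by_contra hcon
  obtain ⟨F', hF', hF'n⟩ := not_subset.1 hcon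
  obtain ⟨F, hF⟩ := hne
  have hclosed : ∀ 𝓖 ⊆ D.faces, IsClosed (⋃ F ∈ 𝓖, closure F) := fun 𝓖 h𝓖 =>
    (D.finite_faces.subset h𝓖).isClosed_biUnion (fun _ _ => isClosed_closure)
  have hc : IsConnected (range D.point)ᶜ :=
    (finite_range D.point).countable.isConnected_compl_of_one_lt_rank
      (by rw [Complex.rank_real_complex]; norm_num)
  have hmeet : ∀ 𝓖 ⊆ D.faces, ∀ F ∈ 𝓖, ((range D.point)ᶜ ∩ ⋃ F ∈ 𝓖, closure F).Nonempty := by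
    intro 𝓖 h𝓖 F hF
    obtain ⟨w, hw⟩ := nonempty_of_mem_complComponents (h𝓖 hF)
    refine ⟨w, fun hw' => subset_compl_of_mem_complComponents (h𝓖 hF) hw (Or.inl hw'), ?_⟩
    simp only [mem_iUnion]
    exact ⟨F, hF, subset_closure hw⟩
  -- The plane without the vertices is connected and covered by the closures of the two families, so
  -- these meet off the vertices: inside an edge, which both families then share, or inside a common
  -- face.
  obtain ⟨z, hz, hz1, hz2⟩ := isPreconnected_closed_iff.1 hc.isPreconnected _ _ (hclosed 𝓕 hsub)
    (hclosed (D.faces \ 𝓕) sdiff_subset) (by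
      intro z _
      obtain ⟨E, hE, hzE⟩ := D.exists_face_mem_closure z
      by_cases hE' : E ∈ 𝓕
      · exact Or.inl (mem_biUnion hE' hzE)
      · exact Or.inr (mem_biUnion (show E ∈ D.faces \ 𝓕 from ⟨hE, hE'⟩) hzE))
    (hmeet _ hsub F hF) (hmeet _ sdiff_subset F' ⟨hF', hF'n⟩)
  simp only [mem_iUnion] at hz1 hz2
  obtain ⟨E, hE, hzE⟩ := hz1
  obtain ⟨E', hE', hzE'⟩ := hz2
  by_cases hzs : z ∈ D.support
  · obtain ⟨e, he, hze⟩ := D.exists_openArc_of_mem_support hzs hz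
    exact hE'.2 (h e E hE E' hE'.1 (D.mem_boundaryEdges_of_mem_closure he (hsub hE) hze hzE)
      (D.mem_boundaryEdges_of_mem_closure he hE'.1 hze hzE'))
  · have := eq_of_mem_complComponents (hsub hE) hE'.1
      (D.eq_of_mem_closure_of_notMem_support (hsub hE) hzs hzE)
      (D.eq_of_mem_closure_of_notMem_support hE'.1 hzs hzE')
    exact hE'.2 (this ▸ hE)

/-- The frontier of F consists of vertices and boundary edges, and the spanning subgraph keeps them
all. -/
theorem mem_faces_boundaryGraph {F : Set ℂ} (hF : F ∈ D.faces) :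
    F ∈ (D.mono (D.boundaryGraph_le F)).faces := by
  refine mem_complComponents_of_frontier_subset (isPreconnected_of_mem_complComponents hF)
    (D.isOpen_face hF) (nonempty_of_mem_complComponents hF)
    ((subset_compl_of_mem_complComponents hF).trans
      (compl_subset_compl.2 (D.support_mono_subset _))) ?_
  intro z hz
  rw [(D.isOpen_face hF).frontier_eq] at hz
  have hzs : z ∈ D.support := by
    by_contra h
    exact hz.2 (D.eq_of_mem_closure_of_notMem_support hF h hz.1)
  by_cases hzp : z ∈ range D.point
  · exact Or.inl hzp
  · obtain ⟨e, he, hze⟩ := D.exists_openArc_of_mem_support hzs hzp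
    have := D.mem_boundaryEdges_of_mem_closure he hF hze hz.1
    rw [← edgeSet_boundaryGraph] at this
    exact (D.mono (D.boundaryGraph_le F)).arc_subset_support this hze.1

/-- F remains a face of the smaller drawing. If the edge were a bridge there, F would be its only
incident face and would swallow the second face that has the edge on its boundary in the full
drawing. -/
theorem not_isBridge_boundaryGraph {F : Set ℂ} (hF : F ∈ D.faces) {e : Sym2 V}
    (he : e ∈ D.boundaryEdges F) (hb : ¬ G.IsBridge e) : ¬ (D.boundaryGraph F).IsBridge e := by
  intro hb'
  set D' := D.mono (D.boundaryGraph_le F) with hD'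
  have heH : e ∈ (D.boundaryGraph F).edgeSet := by rwa [edgeSet_boundaryGraph]
  obtain ⟨F₁, hF₁⟩ := D'.incidentFaces_of_isBridge heH hb'
  have hFF : F ∈ D'.incidentFaces e :=
    ⟨D.mem_faces_boundaryGraph hF, heH, he.2⟩
  obtain ⟨E, E', hne, hEE⟩ := D.incidentFaces_of_not_isBridge he.1 hb
  obtain ⟨F', hF'F, hF', hF'e⟩ : ∃ F', F' ≠ F ∧ F' ∈ D.faces ∧ e ∈ D.boundaryEdges F' := by
    have hE : E ∈ D.incidentFaces e := by rw [hEE]; simp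
    have hE' : E' ∈ D.incidentFaces e := by rw [hEE]; simp
    by_cases h : E = F
    · exact ⟨E', fun h' => hne (h.trans h'.symm), hE'.1, hE'.2⟩
    · exact ⟨E, h, hE.1, hE.2⟩
  obtain ⟨x, hx⟩ := nonempty_of_mem_complComponents hF'
  have hF's : F' ⊆ D'.supportᶜ := (subset_compl_of_mem_complComponents hF').trans
    (compl_subset_compl.2 (D.support_mono_subset _))
  have hsub := (isPreconnected_of_mem_complComponents hF').subset_connectedComponentIn hx hF's
  have hface : connectedComponentIn D'.supportᶜ x ∈ D'.faces :=
    component_mem_complComponents (hF's hx)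
  obtain ⟨z, hz⟩ := D.openArc_nonempty he.1
  have hinc : connectedComponentIn D'.supportᶜ x ∈ D'.incidentFaces e :=
    ⟨hface, D'.mem_boundaryEdges_of_mem_closure heH hface hz
      (closure_mono hsub (frontier_subset_closure (hF'e.2 hz.1)))⟩
  rw [hF₁, mem_singleton_iff] at hFF hinc
  rw [hinc, ← hFF] at hsub
  exact hF'F (eq_of_mem_complComponents hF' hF hx (hsub hx))

end Finite

end PlaneEmbedding

/-! ### Triangles in graphs without four-cycles -/

namespace SimpleGraph

variable {V : Type*} {G : SimpleGraph V}

theorem not_adj_of_free_cycleGraph_four (h : (cycleGraph 4).Free G) {a b c d : V}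
    (hac : a ≠ c) (hbd : b ≠ d) (hab : G.Adj a b) (hbc : G.Adj b c) (hcd : G.Adj c d) :
    ¬ G.Adj d a := by
  intro hda
  apply h
  let f : Fin 4 → V := ![a, b, c, d]
  have hf : Function.Injective f := by
    intro i j hij
    fin_cases i <;> fin_cases j <;>
      simp_all [f, hab.ne, hbc.ne, hcd.ne, hda.ne, hab.ne.symm, hbc.ne.symm, hcd.ne.symm,
        hda.ne.symm, hac.symm, hbd.symm]
  have hadj : ∀ {i j : Fin 4}, (cycleGraph 4).Adj i j → G.Adj (f i) (f j) := by
    intro i j hij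
    rw [cycleGraph_adj] at hij
    fin_cases i <;> fin_cases j <;>
      first
        | exact absurd hij (by decide)
        | simp [f, hab, hbc, hcd, hda, hab.symm, hbc.symm, hcd.symm, hda.symm]
  exact ⟨⟨⟨f, hadj⟩, hf⟩⟩

theorem eq_of_triangles_of_free_cycleGraph_four (h : (cycleGraph 4).Free G) {u v w w' : V}
    (huv : G.Adj u v) (hvw : G.Adj v w) (hwu : G.Adj w u) (hvw' : G.Adj v w')
    (hwu' : G.Adj w' u) : w = w' := by
  by_contra hne
  exact not_adj_of_free_cycleGraph_four h huv.ne hne hwu.symm hvw.symm hvw' hwu'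

/-- `T` is the edge set of a triangle of `G`. -/
def IsTriangleEdges (G : SimpleGraph V) (T : Set (Sym2 V)) : Prop :=
  ∃ u v w, G.Adj u v ∧ G.Adj v w ∧ G.Adj w u ∧ T = {s(u, v), s(v, w), s(w, u)}

theorem IsTriangleEdges.exists_of_mem {T : Set (Sym2 V)} (hT : G.IsTriangleEdges T) {u v : V}
    (h : s(u, v) ∈ T) :
    ∃ w, G.Adj u v ∧ G.Adj v w ∧ G.Adj w u ∧ T = {s(u, v), s(v, w), s(w, u)} := by
  obtain ⟨a, b, c, hab, hbc, hca, rfl⟩ := hT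
  simp only [mem_insert_iff, mem_singleton_iff, Sym2.eq_iff] at h
  rcases h with (⟨rfl, rfl⟩ | ⟨rfl, rfl⟩) | (⟨rfl, rfl⟩ | ⟨rfl, rfl⟩) | (⟨rfl, rfl⟩ | ⟨rfl, rfl⟩)
  · exact ⟨c, hab, hbc, hca, rfl⟩
  · refine ⟨c, hab.symm, hca.symm, hbc.symm, ?_⟩
    ext e
    simp only [mem_insert_iff, mem_singleton_iff,
      Sym2.eq_swap (a := u) (b := v), Sym2.eq_swap (a := u) (b := c), Sym2.eq_swap (a := c) (b := v)]
    tauto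
  · refine ⟨a, hbc, hca, hab, ?_⟩
    ext e
    simp only [mem_insert_iff, mem_singleton_iff]
    tauto
  · refine ⟨a, hbc.symm, hab.symm, hca.symm, ?_⟩
    ext e
    simp only [mem_insert_iff, mem_singleton_iff,
      Sym2.eq_swap (a := u) (b := v), Sym2.eq_swap (a := v) (b := a), Sym2.eq_swap (a := a) (b := u)]
    tauto
  · refine ⟨b, hca, hab, hbc, ?_⟩
    ext e
    simp only [mem_insert_iff, mem_singleton_iff]
    tauto
  · refine ⟨b, hca.symm, hbc.symm, hab.symm, ?_⟩
    ext e
    simp only [mem_insert_iff, mem_singleton_iff,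
      Sym2.eq_swap (a := u) (b := v), Sym2.eq_swap (a := v) (b := b), Sym2.eq_swap (a := b) (b := u)]
    tauto

/-- In a graph without four-cycles, triangles that share an edge are equal. -/
theorem IsTriangleEdges.eq_of_mem (hC : (cycleGraph 4).Free G) {T T' : Set (Sym2 V)}
    (hT : G.IsTriangleEdges T) (hT' : G.IsTriangleEdges T') {e : Sym2 V} (he : e ∈ T)
    (he' : e ∈ T') : T = T' := by
  induction e with | h u v
  obtain ⟨w, h1, h2, h3, rfl⟩ := hT.exists_of_mem he
  obtain ⟨w', h1', h2', h3', rfl⟩ := hT'.exists_of_mem he'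
  rw [eq_of_triangles_of_free_cycleGraph_four hC h1 h2 h3 h2' h3']

theorem IsTriangleEdges.ncard {T : Set (Sym2 V)} (hT : G.IsTriangleEdges T) : T.ncard = 3 := by
  obtain ⟨a, b, c, hab, hbc, hca, rfl⟩ := hT
  rw [ncard_eq_three]
  refine ⟨_, _, _, ?_, ?_, ?_, rfl⟩
  all_goals
    rw [ne_eq, Sym2.eq_iff]
    have := hab.ne
    have := hbc.ne
    have := hca.ne
    grind

theorem IsTriangleEdges.not_isBridge {T : Set (Sym2 V)} (hT : G.IsTriangleEdges T) {e : Sym2 V}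
    (he : e ∈ T) : ¬ G.IsBridge e := by
  induction e with | h u v
  obtain ⟨w, h1, h2, h3, rfl⟩ := hT.exists_of_mem he
  rw [isBridge_iff, not_not]
  have a1 : (G.deleteEdges {s(u, v)}).Adj v w := by
    rw [deleteEdges_adj]
    refine ⟨h2, ?_⟩
    rw [mem_singleton_iff, Sym2.eq_iff]
    have := h1.ne; have := h2.ne; have := h3.ne
    grind
  have a2 : (G.deleteEdges {s(u, v)}).Adj w u := by
    rw [deleteEdges_adj]
    refine ⟨h3, ?_⟩
    rw [mem_singleton_iff, Sym2.eq_iff]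
    have := h1.ne; have := h2.ne; have := h3.ne
    grind
  exact (a1.reachable.trans a2.reachable).symm

/-- A short cycle in a graph without four-cycles is a triangle. -/
theorem Walk.IsCycle.isTriangleEdges (hC : (cycleGraph 4).Free G) {u : V} {p : G.Walk u u}
    (hp : p.IsCycle) (hl : p.length ≤ 4) : G.IsTriangleEdges {e | e ∈ p.edges} := by
  have h3 := hp.three_le_length
  have hnd := hp.support_nodup
  match p, h3, hl, hnd with
  | .cons (v := a) h1 (.cons (v := b) h2 (.cons h3 .nil)), _, _, _ =>
    refine ⟨u, a, b, h1, h2, h3, ?_⟩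
    ext e
    simp
  | .cons (v := a) h1 (.cons (v := b) h2 (.cons (v := c) h3 (.cons h4 .nil))), _, _, hnd =>
    exfalso
    simp only [Walk.support_cons, Walk.support_nil, List.tail_cons, List.nodup_cons,
      List.mem_cons, not_or] at hnd
    refine not_adj_of_free_cycleGraph_four hC ?_ ?_ h1 h2 h3 h4
    · rintro rfl
      tauto
    · rintro rfl
      tauto
  | .cons h1 (.cons h2 (.cons h3 (.cons h4 (.cons h5 q)))), _, hl, _ =>
    simp only [Walk.length_cons] at hl
    omega

end SimpleGraph

/-! ### Short faces -/

namespace PlaneEmbedding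

variable {V : Type*} {G : SimpleGraph V} (D : PlaneEmbedding G)

theorem faceLength_of_isTriangleEdges {F : Set ℂ} (h : G.IsTriangleEdges (D.boundaryEdges F)) :
    D.faceLength F = 3 := by
  rw [faceLength, h.ncard]
  have : {e | e ∈ D.boundaryEdges F ∧ G.IsBridge e} = ∅ := by
    rw [eq_empty_iff_forall_notMem]
    rintro e ⟨he, hb⟩
    exact h.not_isBridge he hb
  rw [this, ncard_empty]

variable [Finite V]

/-- Every boundary edge of a face that is not a bridge lies on a cycle of such edges. -/
theorem exists_cycle_of_mem_boundaryEdges {F : Set ℂ} (hF : F ∈ D.faces) {e : Sym2 V}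
    (he : e ∈ D.boundaryEdges F) (hb : ¬ G.IsBridge e) :
    ∃ (u : V) (p : G.Walk u u), p.IsCycle ∧ e ∈ p.edges ∧
      ∀ e' ∈ p.edges, e' ∈ D.boundaryEdges F ∧ ¬ G.IsBridge e' := by
  have h := D.not_isBridge_boundaryGraph hF he hb
  rw [SimpleGraph.isBridge_iff_forall_cycle_notMem (by rwa [edgeSet_boundaryGraph])] at h
  push Not at h
  obtain ⟨u, p, hp, hep⟩ := h
  have hedges : (p.mapLe (D.boundaryGraph_le F)).edges = p.edges := by simp
  have hcyc := hp.mapLe (D.boundaryGraph_le F)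
  refine ⟨u, p.mapLe (D.boundaryGraph_le F), hcyc, by rwa [hedges], fun e' he' => ⟨?_, ?_⟩⟩
  · rw [hedges] at he'
    have := p.edges_subset_edgeSet he'
    rwa [edgeSet_boundaryGraph] at this
  · exact fun hb' => hb'.notMem_edges_of_isCycle hcyc he'

/-- The non-bridge edges are covered by cycles among themselves, here triangles. Two different
triangles are edge-disjoint and would need six edges. -/
theorem isTriangleEdges_of_ncard_le_four (hC : (SimpleGraph.cycleGraph 4).Free G) {F : Set ℂ}
    (hF : F ∈ D.faces) (hne : {e | e ∈ D.boundaryEdges F ∧ ¬ G.IsBridge e}.Nonempty)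
    (h4 : {e | e ∈ D.boundaryEdges F ∧ ¬ G.IsBridge e}.ncard ≤ 4) :
    G.IsTriangleEdges {e | e ∈ D.boundaryEdges F ∧ ¬ G.IsBridge e} := by
  classical
  set S := {e | e ∈ D.boundaryEdges F ∧ ¬ G.IsBridge e} with hS
  have key : ∀ e ∈ S, ∃ T ⊆ S, e ∈ T ∧ G.IsTriangleEdges T := by
    intro e he
    obtain ⟨u, p, hp, hep, hpS⟩ := D.exists_cycle_of_mem_boundaryEdges hF he.1 he.2
    refine ⟨{e | e ∈ p.edges}, hpS, hep, hp.isTriangleEdges hC ?_⟩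
    have h1 : ({e | e ∈ p.edges} : Set (Sym2 V)).ncard = p.length := by
      rw [← p.length_edges, ← List.toFinset_card_of_nodup hp.edges_nodup, ← ncard_coe_finset]
      congr 1
      ext e
      simp
    rw [← h1]
    exact (ncard_le_ncard (show {e | e ∈ p.edges} ⊆ S from hpS) (toFinite _)).trans h4
  obtain ⟨e, he⟩ := hne
  obtain ⟨T, hTS, heT, hT⟩ := key e he
  have : S ⊆ T := by
    intro e' he'
    obtain ⟨T', hTS', heT', hT'⟩ := key e' he'
    have hmeet : (T ∩ T').Nonempty := by
      by_contra hem
      rw [not_nonempty_iff_eq_empty] at hem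
      have h1 := ncard_union_eq (disjoint_iff_inter_eq_empty.2 hem) (toFinite _) (toFinite _)
      have h2 := ncard_le_ncard (union_subset hTS hTS') (toFinite _)
      rw [hT.ncard, hT'.ncard] at h1
      omega
    obtain ⟨e'', h1, h2⟩ := hmeet
    rw [hT.eq_of_mem hC hT' h1 h2]
    exact heT'
  rwa [Subset.antisymm this hTS]

theorem incidentFaces_nonempty {e : Sym2 V} (he : e ∈ G.edgeSet) :
    (D.incidentFaces e).Nonempty := by
  by_cases hb : G.IsBridge e
  · obtain ⟨F, hF⟩ := D.incidentFaces_of_isBridge he hb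
    exact hF ▸ singleton_nonempty F
  · obtain ⟨F, F', -, hF⟩ := D.incidentFaces_of_not_isBridge he hb
    exact hF ▸ insert_nonempty F _

theorem faceLength_eq (F : Set ℂ) : D.faceLength F =
    {e | e ∈ D.boundaryEdges F ∧ ¬ G.IsBridge e}.ncard +
      2 * {e | e ∈ D.boundaryEdges F ∧ G.IsBridge e}.ncard := by
  have h : D.boundaryEdges F = {e | e ∈ D.boundaryEdges F ∧ ¬ G.IsBridge e} ∪
      {e | e ∈ D.boundaryEdges F ∧ G.IsBridge e} := by
    ext e
    simp only [mem_union, mem_ofPred_eq]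
    tauto
  have hd : Disjoint {e | e ∈ D.boundaryEdges F ∧ ¬ G.IsBridge e}
      {e | e ∈ D.boundaryEdges F ∧ G.IsBridge e} := by
    rw [Set.disjoint_left]
    rintro e ⟨-, h1⟩ ⟨-, h2⟩
    exact h1 h2
  have := ncard_union_eq hd (toFinite _) (toFinite _)
  rw [← h] at this
  rw [faceLength, this]
  ring

/-- In a connected graph without four-cycles on at least four vertices, every face is a triangle
or has length at least five. -/
theorem isTriangleEdges_or_five_le (hG : G.Connected) (hn : 4 ≤ Nat.card V)
    (hC : (SimpleGraph.cycleGraph 4).Free G) {F : Set ℂ} (hF : F ∈ D.faces) :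
    G.IsTriangleEdges (D.boundaryEdges F) ∨ 5 ≤ D.faceLength F := by
  have hlen := D.faceLength_eq F
  rcases eq_empty_or_nonempty {e | e ∈ D.boundaryEdges F ∧ ¬ G.IsBridge e} with h0 | hne
  · right
    have hall : ∀ e ∈ D.boundaryEdges F, G.IsBridge e := by
      intro e he
      by_contra hb
      have : e ∈ {e | e ∈ D.boundaryEdges F ∧ ¬ G.IsBridge e} := ⟨he, hb⟩
      rw [h0] at this
      exact this
    -- If all boundary edges are bridges, no other face shares an edge with F, so F is the only
    -- face. By Euler's formula ε = n - 1 ≥ 3, and every edge counts twice.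
    have hfaces : ({F} : Set (Set ℂ)) = D.faces := by
      refine D.eq_faces_of_forall_incident (by simpa using hF) (singleton_nonempty F) ?_
      intro e E hE' F' hF' he he'
      rw [mem_singleton_iff.1 hE'] at he
      obtain ⟨E, hE⟩ := D.incidentFaces_of_isBridge he.1 (hall e he)
      have h1 : F ∈ D.incidentFaces e := ⟨hF, he⟩
      have h2 : F' ∈ D.incidentFaces e := ⟨hF', he'⟩
      rw [hE] at h1 h2
      exact h2.trans h1.symm
    have hbd : {e | e ∈ D.boundaryEdges F ∧ G.IsBridge e} = G.edgeSet := by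
      ext e
      refine ⟨fun h => h.1.1, fun h => ?_⟩
      obtain ⟨F', hF', he⟩ := D.incidentFaces_nonempty h
      rw [← hfaces, mem_singleton_iff] at hF'
      subst hF'
      exact ⟨he, hall e he⟩
    have heuler := D.ncard_faces_add_card hG
    rw [← hfaces, ncard_singleton] at heuler
    rw [hbd] at hlen
    omega
  · by_cases h4 : {e | e ∈ D.boundaryEdges F ∧ ¬ G.IsBridge e}.ncard ≤ 4
    · have ht := D.isTriangleEdges_of_ncard_le_four hC hF hne h4
      rcases eq_empty_or_nonempty {e | e ∈ D.boundaryEdges F ∧ G.IsBridge e} with hb | hb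
      · left
        convert ht using 1
        ext e
        refine ⟨fun h => ⟨h, fun hb' => ?_⟩, fun h => h.1⟩
        have : e ∈ {e | e ∈ D.boundaryEdges F ∧ G.IsBridge e} := ⟨h, hb'⟩
        rw [hb] at this
        exact this
      -- A triangle together with at least one bridge has length at least 3 + 2.
      · right
        have := (ncard_pos (toFinite _)).2 hb
        rw [ht.ncard] at hlen
        omega
    · right
      omega

theorem isTriangleEdges_of_faceLength_eq_three (hG : G.Connected) (hn : 4 ≤ Nat.card V)
    (hC : (SimpleGraph.cycleGraph 4).Free G) {F : Set ℂ} (hF : F ∈ D.faces)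
    (h3 : D.faceLength F = 3) : G.IsTriangleEdges (D.boundaryEdges F) := by
  rcases D.isTriangleEdges_or_five_le hG hn hC hF with h | h
  · exact h
  · omega

/-- Two triangular faces do not share an edge. -/
theorem eq_of_mem_boundaryEdges_of_faceLength_eq_three (hG : G.Connected) (hn : 4 ≤ Nat.card V)
    (hC : (SimpleGraph.cycleGraph 4).Free G) {F F' : Set ℂ} (hF : F ∈ D.faces)
    (hF' : F' ∈ D.faces) (h3 : D.faceLength F = 3) (h3' : D.faceLength F' = 3) {e : Sym2 V}
    (he : e ∈ D.boundaryEdges F) (he' : e ∈ D.boundaryEdges F') : F = F' := by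
  by_contra hne
  have hT := D.isTriangleEdges_of_faceLength_eq_three hG hn hC hF h3
  have hT' := D.isTriangleEdges_of_faceLength_eq_three hG hn hC hF' h3'
  have hTT := hT.eq_of_mem hC hT' he he'
  have hinc : ∀ e ∈ D.boundaryEdges F, D.incidentFaces e = {F, F'} := by
    intro e he
    obtain ⟨E, E', hEE, hE⟩ := D.incidentFaces_of_not_isBridge he.1 (hT.not_isBridge he)
    refine (eq_of_subset_of_ncard_le ?_ ?_ (by rw [hE]; exact toFinite _)).symm
    · rintro _ (rfl | rfl)
      · exact ⟨hF, he⟩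
      · exact ⟨hF', hTT ▸ he⟩
    · rw [hE, ncard_pair hne, ncard_pair hEE]
  -- Both sides of each edge of the common triangle are taken by F and F', so there is no further
  -- face or edge. Euler's formula then gives n = 3.
  have hfaces : ({F, F'} : Set (Set ℂ)) = D.faces := by
    refine D.eq_faces_of_forall_incident ?_ (insert_nonempty _ _) ?_
    · rintro _ (rfl | rfl) <;> assumption
    · rintro e E hE E' hE' heE heE'
      have : e ∈ D.boundaryEdges F := by
        rcases hE with rfl | rfl
        · exact heE
        · rwa [hTT]
      rw [← hinc e this]
      exact ⟨hE', heE'⟩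
  have hbd : D.boundaryEdges F = G.edgeSet := by
    ext e
    refine ⟨fun h => h.1, fun h => ?_⟩
    obtain ⟨E, hE, heE⟩ := D.incidentFaces_nonempty h
    rw [← hfaces] at hE
    rcases hE with rfl | rfl
    · exact heE
    · rwa [hTT]
  have heuler := D.ncard_faces_add_card hG
  rw [← hfaces, ncard_pair hne, ← hbd, hT.ncard] at heuler
  omega

end PlaneEmbedding

/-! ### Double counting -/

theorem Set.ncard_eq_sum_ite {α : Type*} {s : Finset α} {T : Set α} (P : α → Prop)
    [DecidablePred P] (h : ∀ x, x ∈ T ↔ x ∈ s ∧ P x) : T.ncard = ∑ x ∈ s, if P x then 1 else 0 := by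
  classical
  have : T = ((s.filter P : Finset α) : Set α) := by
    ext x
    simp [h]
  rw [this, ncard_coe_finset, Finset.card_filter]

namespace PlaneEmbedding

section Counting

variable {V : Type*} [Finite V] {G : SimpleGraph V} (D : PlaneEmbedding G)

/-- The sum of the lengths of the faces is twice the number of edges. -/
theorem sum_faceLength :
    ∑ F ∈ D.finite_faces.toFinset, D.faceLength F = 2 * G.edgeSet.ncard := by
  classical
  let E : Finset (Sym2 V) := (toFinite G.edgeSet).toFinset
  have hE : ∀ e, e ∈ E ↔ e ∈ G.edgeSet := fun e => (toFinite G.edgeSet).mem_toFinset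
  have hlen : ∀ F, D.faceLength F = ∑ e ∈ E,
      ((if e ∈ D.boundaryEdges F then 1 else 0) +
        if e ∈ D.boundaryEdges F ∧ G.IsBridge e then 1 else 0) := by
    intro F
    rw [Finset.sum_add_distrib, faceLength]
    congr 1
    · exact ncard_eq_sum_ite _ fun e => ⟨fun h => ⟨(hE e).2 h.1, h⟩, fun h => h.2⟩
    · exact ncard_eq_sum_ite _ fun e => ⟨fun h => ⟨(hE e).2 h.1.1, h⟩, fun h => h.2⟩
  simp only [hlen]
  rw [Finset.sum_comm]
  have hinc : ∀ e, (D.incidentFaces e).ncard = ∑ F ∈ D.finite_faces.toFinset,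
      if e ∈ D.boundaryEdges F then 1 else 0 := fun e =>
    ncard_eq_sum_ite _ fun F => by rw [D.finite_faces.mem_toFinset]; rfl
  -- A bridge has one incident face, where it counts twice; any other edge has two.
  have htwo : ∀ e ∈ E, ∑ F ∈ D.finite_faces.toFinset, ((if e ∈ D.boundaryEdges F then 1 else 0) +
        if e ∈ D.boundaryEdges F ∧ G.IsBridge e then 1 else 0) = 2 := by
    intro e he
    rw [Finset.sum_add_distrib, ← hinc]
    by_cases hb : G.IsBridge e
    · obtain ⟨F, hF⟩ := D.incidentFaces_of_isBridge ((hE e).1 he) hb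
      simp only [hb, and_true]
      rw [← hinc, hF, ncard_singleton]
    · obtain ⟨F, F', hne, hF⟩ := D.incidentFaces_of_not_isBridge ((hE e).1 he) hb
      simp [hb, hF, ncard_pair hne]
  rw [Finset.sum_congr rfl htwo, Finset.sum_const, smul_eq_mul, mul_comm,
    ncard_eq_toFinset_card G.edgeSet]

/-- The edges are partitioned into the boundaries of the triangular faces and the uncovered
edges. -/
theorem three_mul_numFaces_add_tau (hG : G.Connected) (hn : 4 ≤ Nat.card V)
    (hC : (SimpleGraph.cycleGraph 4).Free G) :
    3 * D.numFaces 3 + D.tau = G.edgeSet.ncard := by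
  classical
  let E : Finset (Sym2 V) := (toFinite G.edgeSet).toFinset
  have hE : ∀ e, e ∈ E ↔ e ∈ G.edgeSet := fun e => (toFinite G.edgeSet).mem_toFinset
  have h1 : D.numFaces 3 = ∑ F ∈ D.finite_faces.toFinset, if D.faceLength F = 3 then 1 else 0 :=
    ncard_eq_sum_ite _ fun F => by rw [D.finite_faces.mem_toFinset]; rfl
  have h2 : D.tau = ∑ e ∈ E,
      if ¬ ∃ F ∈ D.faces, D.faceLength F = 3 ∧ e ∈ D.boundaryEdges F then 1 else 0 :=
    ncard_eq_sum_ite _ fun e => by rw [hE]; rfl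
  have h3 : ∀ F ∈ D.finite_faces.toFinset, 3 * (if D.faceLength F = 3 then 1 else 0) =
      ∑ e ∈ E, if D.faceLength F = 3 ∧ e ∈ D.boundaryEdges F then 1 else 0 := by
    intro F hF
    rw [D.finite_faces.mem_toFinset] at hF
    by_cases hl : D.faceLength F = 3
    · simp only [hl, if_true, true_and]
      rw [← ncard_eq_sum_ite (T := D.boundaryEdges F) _ fun e =>
        ⟨fun h => ⟨(hE e).2 h.1, h⟩, fun h => h.2⟩,
        (D.isTriangleEdges_of_faceLength_eq_three hG hn hC hF hl).ncard]
    · simp [hl]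
  rw [h1, h2, Finset.mul_sum, Finset.sum_congr rfl h3, Finset.sum_comm, ← Finset.sum_add_distrib]
  have h4 : ∀ e ∈ E, (∑ F ∈ D.finite_faces.toFinset,
        if D.faceLength F = 3 ∧ e ∈ D.boundaryEdges F then 1 else 0) +
      (if ¬ ∃ F ∈ D.faces, D.faceLength F = 3 ∧ e ∈ D.boundaryEdges F then 1 else 0) = 1 := by
    intro e he
    by_cases hex : ∃ F ∈ D.faces, D.faceLength F = 3 ∧ e ∈ D.boundaryEdges F
    · rw [if_neg (not_not.2 hex), add_zero]
      obtain ⟨F, hF, hl, heF⟩ := hex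
      rw [Finset.sum_eq_single F]
      · simp [hl, heF]
      · intro F' hF' hne
        rw [D.finite_faces.mem_toFinset] at hF'
        rw [if_neg]
        rintro ⟨hl', heF'⟩
        exact hne (D.eq_of_mem_boundaryEdges_of_faceLength_eq_three hG hn hC hF' hF hl' hl heF' heF)
      · intro h
        exact absurd (D.finite_faces.mem_toFinset.2 hF) h
    · rw [if_pos hex, Finset.sum_eq_zero]
      intro F hF
      rw [D.finite_faces.mem_toFinset] at hF
      rw [if_neg]
      rintro ⟨hl, heF⟩
      exact hex ⟨F, hF, hl, heF⟩
  rw [Finset.sum_congr rfl h4, Finset.sum_const, smul_eq_mul, mul_one,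
    ncard_eq_toFinset_card G.edgeSet]

/-- Regrouping the faces by length. As there are finitely many, the supremum `maxFaceLength` is an
upper bound and no long face is lost. -/
theorem sum_mul_numFaces (w : ℕ → ℝ) :
    ∑ k ∈ Finset.Icc 6 D.maxFaceLength, w k * (D.numFaces k : ℝ) =
      ∑ F ∈ D.finite_faces.toFinset, if 6 ≤ D.faceLength F then w (D.faceLength F) else 0 := by
  classical
  rw [← Finset.sum_filter]
  have hmaps : ∀ F ∈ D.finite_faces.toFinset.filter (fun F => 6 ≤ D.faceLength F),
      D.faceLength F ∈ Finset.Icc 6 D.maxFaceLength := by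
    intro F hF
    rw [Finset.mem_filter, D.finite_faces.mem_toFinset] at hF
    rw [Finset.mem_Icc]
    exact ⟨hF.2, le_csSup (D.finite_faces.image _).bddAbove (mem_image_of_mem _ hF.1)⟩
  rw [← Finset.sum_fiberwise_of_maps_to hmaps]
  refine Finset.sum_congr rfl fun k hk => ?_
  rw [Finset.mem_Icc] at hk
  rw [Finset.sum_congr rfl (g := fun _ => w k) (fun F hF => by rw [(Finset.mem_filter.1 hF).2]),
    Finset.sum_const, nsmul_eq_mul, mul_comm]
  congr 2
  rw [numFaces, ← ncard_coe_finset]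
  congr 1
  ext F
  simp only [mem_ofPred_eq, Finset.coe_filter, Finset.mem_filter, D.finite_faces.mem_toFinset]
  constructor
  · rintro ⟨h, rfl⟩
    exact ⟨⟨h, hk.1⟩, rfl⟩
  · rintro ⟨⟨h, -⟩, h'⟩
    exact ⟨h, h'⟩

/-- The exact number of edges of a connected plane graph without four-cycles. -/
theorem ncard_edgeSet_eq (hG : G.Connected) (hn : 4 ≤ Nat.card V)
    (hC : (SimpleGraph.cycleGraph 4).Free G) :
    (G.edgeSet.ncard : ℝ) = 15 / 7 * ((Nat.card V : ℝ) - 2) - 2 / 7 * (D.tau : ℝ)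
        - ∑ k ∈ Finset.Icc 6 D.maxFaceLength, 3 * ((k : ℝ) - 5) / 7 * (D.numFaces k : ℝ) := by
  classical
  have heuler : (D.faces.ncard : ℝ) + Nat.card V = G.edgeSet.ncard + 2 := by
    exact_mod_cast D.ncard_faces_add_card hG
  have hsum : ∑ F ∈ D.finite_faces.toFinset, (D.faceLength F : ℝ) = 2 * G.edgeSet.ncard := by
    exact_mod_cast D.sum_faceLength
  have htau : 3 * (D.numFaces 3 : ℝ) + D.tau = G.edgeSet.ncard := by
    exact_mod_cast D.three_mul_numFaces_add_tau hG hn hC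
  have hthree : (D.numFaces 3 : ℝ) =
      ∑ F ∈ D.finite_faces.toFinset, if D.faceLength F = 3 then (1 : ℝ) else 0 := by
    have : D.numFaces 3 = ∑ F ∈ D.finite_faces.toFinset, if D.faceLength F = 3 then 1 else 0 :=
      ncard_eq_sum_ite _ fun F => by rw [D.finite_faces.mem_toFinset]; rfl
    exact_mod_cast this
  have hcard : (D.faces.ncard : ℝ) = ∑ F ∈ D.finite_faces.toFinset, (1 : ℝ) := by
    rw [Finset.sum_const, nsmul_eq_mul, mul_one, ncard_eq_toFinset_card D.faces D.finite_faces]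
  -- Facewise, length - 5 corrected by 2 on triangles vanishes for lengths 3 and 5, the only ones
  -- below 6. The factor 7/3 undoes the normalisation of the weights.
  have hfaces : ∑ F ∈ D.finite_faces.toFinset, ((D.faceLength F : ℝ) - 5 * 1 +
      2 * (if D.faceLength F = 3 then (1 : ℝ) else 0)) = ∑ F ∈ D.finite_faces.toFinset, 7 / 3 *
        (if 6 ≤ D.faceLength F then 3 * ((D.faceLength F : ℝ) - 5) / 7 else 0) := by
    refine Finset.sum_congr rfl fun F hF => ?_
    rw [D.finite_faces.mem_toFinset] at hF
    rcases D.isTriangleEdges_or_five_le hG hn hC hF with h | h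
    · rw [D.faceLength_of_isTriangleEdges h]
      norm_num
    · rw [if_neg (by omega)]
      by_cases h6 : 6 ≤ D.faceLength F
      · rw [if_pos h6]
        ring
      · have h5 : D.faceLength F = 5 := by omega
        rw [h5]
        norm_num
  rw [Finset.sum_add_distrib, Finset.sum_sub_distrib, ← Finset.mul_sum, ← Finset.mul_sum,
    ← Finset.mul_sum, ← hthree, ← hcard, hsum] at hfaces
  rw [D.sum_mul_numFaces (fun k => 3 * ((k : ℝ) - 5) / 7)]
  linarith

theorem seven_mul_ncard_edgeSet_le (D : PlaneEmbedding G) (hG : G.Connected) (hn : 4 ≤ Nat.card V)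
    (hC : (SimpleGraph.cycleGraph 4).Free G) :
    7 * G.edgeSet.ncard + 30 ≤ 15 * Nat.card V := by
  have h := D.ncard_edgeSet_eq hG hn hC
  have h1 : 0 ≤ ∑ k ∈ Finset.Icc 6 D.maxFaceLength,
      3 * ((k : ℝ) - 5) / 7 * (D.numFaces k : ℝ) := by
    refine Finset.sum_nonneg fun k hk => ?_
    have : (6 : ℝ) ≤ k := by exact_mod_cast (Finset.mem_Icc.1 hk).1
    have : 0 ≤ (k : ℝ) - 5 := by linarith
    positivity
  have h2 : (0 : ℝ) ≤ D.tau := Nat.cast_nonneg _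
  have : (7 * G.edgeSet.ncard + 30 : ℝ) ≤ 15 * Nat.card V := by linarith
  exact_mod_cast this

/-- If every triangle bounds a face, the uncovered edges are those in no triangle. -/
theorem tau_eq (hG : G.Connected) (hn : 4 ≤ Nat.card V)
    (hC : (SimpleGraph.cycleGraph 4).Free G) (hT : D.TrianglesBoundFaces) :
    D.tau = (edgesInNoTriangle G).ncard := by
  rw [tau]
  congr 1
  ext e
  refine and_congr_right fun he => not_congr ⟨?_, ?_⟩
  · rintro ⟨F, hF, hl, heF⟩
    have ht := D.isTriangleEdges_of_faceLength_eq_three hG hn hC hF hl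
    induction e with | h u v
    obtain ⟨w, h1, h2, h3, -⟩ := ht.exists_of_mem heF
    exact ⟨u, v, w, h1, h2, h3, rfl⟩
  · rintro ⟨u, v, w, h1, h2, h3, rfl⟩
    obtain ⟨F, hF, hb⟩ := hT u v w h1 h2 h3
    exact ⟨F, hF, D.faceLength_of_isTriangleEdges ⟨u, v, w, h1, h2, h3, hb⟩, by simp [hb]⟩

end Counting

/-! ### Disconnected graphs -/

/-- The drawing of an induced subgraph. -/
def induce {V : Type*} {G : SimpleGraph V} (D : PlaneEmbedding G) (s : Set V) :
    PlaneEmbedding (G.induce s) where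
  point w := D.point w
  arc e := D.arc (e.map Subtype.val)
  point_injective := D.point_injective.comp Subtype.val_injective
  isPlaneArc u v huv := D.isPlaneArc u v huv
  mem_of_point_mem_arc e he w hw := by
    induction e with | h u v
    have := D.mem_of_point_mem_arc s((u : V), v) he w hw
    simpa [Sym2.mem_iff, Subtype.ext_iff] using this
  arc_inter_arc e he e' he' hne := by
    induction e with | h u v
    induction e' with | h u' v'
    have hne' : s((u : V), (v : V)) ≠ s((u' : V), (v' : V)) := fun h =>
      hne (Sym2.map.injective Subtype.val_injective h)
    intro z hz
    obtain ⟨w, ⟨hw, hw'⟩, rfl⟩ := D.arc_inter_arc _ he _ he' hne' hz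
    have hws : w ∈ s := by
      rcases Sym2.mem_iff.1 hw with rfl | rfl
      · exact u.2
      · exact v.2
    refine ⟨⟨w, hws⟩, ⟨?_, ?_⟩, rfl⟩
    · simpa [Sym2.mem_iff, Subtype.ext_iff] using hw
    · simpa [Sym2.mem_iff, Subtype.ext_iff] using hw'

end PlaneEmbedding

namespace SimpleGraph

variable {V : Type*} {G : SimpleGraph V}

theorem ncard_edgeSet_le_induce_add_induce [Finite V] {s : Set V}
    (hs : ∀ u v, G.Adj u v → u ∈ s → v ∈ s) :
    G.edgeSet.ncard ≤ (G.induce s).edgeSet.ncard + (G.induce sᶜ).edgeSet.ncard := by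
  have hsub : G.edgeSet ⊆ Sym2.map (↑) '' (G.induce s).edgeSet ∪
      Sym2.map (↑) '' (G.induce sᶜ).edgeSet := by
    intro e he
    induction e with | h u v
    by_cases hu : u ∈ s
    · exact Or.inl ⟨s(⟨u, hu⟩, ⟨v, hs u v he hu⟩), he, rfl⟩
    · have hv : v ∉ s := fun hv => hu (hs v u (Adj.symm he) hv)
      exact Or.inr ⟨s(⟨u, hu⟩, ⟨v, hv⟩), he, rfl⟩
  exact (ncard_le_ncard hsub (toFinite _)).trans ((ncard_union_le _ _).trans
    (add_le_add (ncard_image_le (toFinite _)) (ncard_image_le (toFinite _))))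

theorem exists_closed_of_not_connected [Nonempty V] (h : ¬ G.Connected) :
    ∃ s : Set V, s.Nonempty ∧ sᶜ.Nonempty ∧ ∀ u v, G.Adj u v → u ∈ s → v ∈ s := by
  rw [connected_iff] at h
  simp only [Preconnected, not_and, not_nonempty_iff] at h
  have h : ¬ ∀ u v, G.Reachable u v := fun hp => (h hp).false (Classical.arbitrary V)
  push Not at h
  obtain ⟨u, v, huv⟩ := h
  exact ⟨{w | G.Reachable u w}, ⟨u, Reachable.refl u⟩, ⟨v, huv⟩,
    fun a b hab ha => Reachable.trans ha hab.reachable⟩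

theorem free_induce {W : Type*} {A : SimpleGraph W} (h : A.Free G) (s : Set V) :
    A.Free (G.induce s) := fun hc => h (hc.trans ⟨(Embedding.induce s).toCopy⟩)

end SimpleGraph

universe u

namespace PlaneEmbedding

/-- The constant 15 instead of 30 admits graphs on one to three vertices, with equality for one
vertex, and the bound survives addition over separate parts. -/
theorem seven_mul_ncard_edgeSet_add_le {V : Type u} [Finite V] [Nonempty V] {G : SimpleGraph V}
    (D : PlaneEmbedding G) (hC : (SimpleGraph.cycleGraph 4).Free G) :
    7 * G.edgeSet.ncard + 15 ≤ 15 * Nat.card V := by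
  induction hn : Nat.card V using Nat.strong_induction_on generalizing V with
  | _ n ih =>
    by_cases hG : G.Connected
    · by_cases h4 : 4 ≤ n
      · have := D.seven_mul_ncard_edgeSet_le hG (hn ▸ h4) hC
        omega
      · classical
        have := Fintype.ofFinite V
        have h1 := G.card_edgeFinset_le_card_choose_two
        rw [← Nat.card_eq_fintype_card, hn] at h1
        have h2 : G.edgeSet.ncard = G.edgeFinset.card := by
          rw [← SimpleGraph.coe_edgeFinset, ncard_coe_finset]
        have h3 : 0 < Nat.card V := Nat.card_pos
        rw [h2]
        rw [hn] at h3
        rw [Nat.choose_two_right] at h1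
        -- For n = 1, 2, 3 the bound n(n - 1)/2 on the number of edges is enough.
        interval_cases n <;> omega
    · obtain ⟨s, hs, hs', hcl⟩ := SimpleGraph.exists_closed_of_not_connected hG
      have h1 := SimpleGraph.ncard_edgeSet_le_induce_add_induce hcl
      have := hs.to_subtype
      have := hs'.to_subtype
      have hcard := ncard_add_ncard_compl s
      have p1 := (ncard_pos (toFinite _)).2 hs
      have p2 := (ncard_pos (toFinite _)).2 hs'
      have e1 := ih _ (by omega) (D.induce s) (SimpleGraph.free_induce hC s)
        (Nat.card_coe_set_eq s)
      have e2 := ih _ (by omega) (D.induce sᶜ) (SimpleGraph.free_induce hC sᶜ)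
        (Nat.card_coe_set_eq sᶜ)
      omega

/-- Each of the two parts contributes 15, which restores the constant 30. -/
theorem seven_mul_ncard_edgeSet_le_of_not_connected {V : Type u} [Finite V] [Nonempty V]
    {G : SimpleGraph V} (D : PlaneEmbedding G) (hC : (SimpleGraph.cycleGraph 4).Free G)
    (hG : ¬ G.Connected) : 7 * G.edgeSet.ncard + 30 ≤ 15 * Nat.card V := by
  obtain ⟨s, hs, hs', hcl⟩ := SimpleGraph.exists_closed_of_not_connected hG
  have h1 := SimpleGraph.ncard_edgeSet_le_induce_add_induce hcl
  have := hs.to_subtype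
  have := hs'.to_subtype
  have hcard := ncard_add_ncard_compl s
  have e1 := (D.induce s).seven_mul_ncard_edgeSet_add_le (SimpleGraph.free_induce hC s)
  have e2 := (D.induce sᶜ).seven_mul_ncard_edgeSet_add_le (SimpleGraph.free_induce hC sᶜ)
  rw [Nat.card_coe_set_eq] at e1 e2
  omega

end PlaneEmbedding

theorem theorem3 {V : Type*} [Fintype V] (G : SimpleGraph V) (D : PlaneEmbedding G)
    (hn : 4 ≤ Fintype.card V) (hC4 : (SimpleGraph.cycleGraph 4).Free G) :
    (G.edgeSet.ncard : ℝ) ≤ 15 / 7 * ((Fintype.card V : ℝ) - 2) ∧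
    (G.Connected →
      D.faces.Finite ∧
      (G.edgeSet.ncard : ℝ) = 15 / 7 * ((Fintype.card V : ℝ) - 2) - 2 / 7 * (D.tau : ℝ)
        - ∑ k ∈ Finset.Icc 6 D.maxFaceLength, 3 * ((k : ℝ) - 5) / 7 * (D.numFaces k : ℝ) ∧
      (D.TrianglesBoundFaces → D.tau = (edgesInNoTriangle G).ncard)) := by
  rw [← Nat.card_eq_fintype_card] at hn ⊢
  refine ⟨?_, fun hG => ⟨D.finite_faces, D.ncard_edgeSet_eq hG hn hC4, D.tau_eq hG hn hC4⟩⟩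
  have : Nonempty V := (Nat.card_pos_iff.1 (by omega)).1
  have h : 7 * G.edgeSet.ncard + 30 ≤ 15 * Nat.card V := by
    by_cases hG : G.Connected
    · exact D.seven_mul_ncard_edgeSet_le hG hn hC4
    · exact D.seven_mul_ncard_edgeSet_le_of_not_connected hC4 hG
  have h' : (7 * G.edgeSet.ncard + 30 : ℝ) ≤ 15 * Nat.card V := by exact_mod_cast h
  linarith
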